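/- Let $N\ge 1$, let $\mathcal D\subset\mathbb R^N$ be open, bounded and connected, and let $F:\partial\mathcal D\to\mathbb R$ be continuous. Let $w_1,w_2,\dots$ be independent random variables, each uniformly distributed (with respect to Lebesgue measure) on the open unit ball $B_1(0)\subset\mathbb R^N$, realised as the coordinates of the countable product space $\Omega=B_1(0)^{\mathbb N}$ with the product probability measure $\mathbb P$. For $\epsilon\in(0,1)$ and $x_0\in\mathcal D$, the ball walk is the process $$X_0^{\epsilon,x_0}=x_0,\qquad X_n^{\epsilon,x_0}=X_{n-1}^{\epsilon,x_0}+\min\{\epsilon,\operatorname{dist}(X_{n-1}^{\epsilon,x_0},\partial\mathcal D)\}\,w_n\quad(n\ge1).$$ It converges $\mathbb P$-almost surely to a random variable $X^{\epsilon,x_0}$ with values in $\partial\mathcal D$; put $$u^\epsilon(x_0)=\mathbb E\big[F(X^{\epsilon,x_0})\big]=\int_\Omega F\circ X^{\epsilon,x_0}\,d\mathbb P .$$ **Theorem 2.9.** Let $(\epsilon_k)_{k}$ be a sequence in $(0,1)$ with $\epsilon_k\to0$. Assume that the functions $u^{\epsilon_k}$ converge, as $k\to\infty$, locally uniformly in $\mathcal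 D$ to some continuous $u:\mathcal D\to\mathbb R$. Then $u$ is harmonic in $\mathcal D$, i.e. $u\in C^2(\mathcal D)$ and $\Delta u=0$ in $\mathcal D$. -/

import Mathlib

open MeasureTheory Filter Topology

namespace BallWalk

noncomputable section

/-- The open unit ball of `ℝ^N`, the sample space of a single step. -/
abbrev UnitBall (N : ℕ) : Type := Metric.ball (0 : EuclideanSpace ℝ (Fin N)) 1

/-- The normalised Lebesgue measure on the unit ball. -/
def stepMeasure (N : ℕ) : Measure (UnitBall N) :=
  (volume (Metric.ball (0 : EuclideanSpace ℝ (Fin N)) 1))⁻¹ • Measure.comap Subtype.val volume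

/-- On Borel sets, `stepMeasure` is `|A| / |B_1(0)|`. -/
theorem stepMeasure_apply (N : ℕ) (A : Set (UnitBall N)) :
    stepMeasure N A = volume (Subtype.val '' A) /
      volume (Metric.ball (0 : EuclideanSpace ℝ (Fin N)) 1) := by
  rw [stepMeasure, Measure.smul_apply, smul_eq_mul,
    (MeasurableEmbedding.subtype_coe Metric.isOpen_ball.measurableSet).comap_apply,
    ENNReal.div_eq_inv_mul]

instance stepMeasure_isProbabilityMeasure (N : ℕ) : IsProbabilityMeasure (stepMeasure N) := by
  constructor
  rw [stepMeasure_apply, Set.image_univ, Subtype.range_coe]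
  exact ENNReal.div_self (Metric.measure_ball_pos volume _ one_pos).ne' measure_ball_lt_top.ne

/-- The sample space of the whole walk: sequences of points of the unit ball
(the coordinate `ω n` drives step number `n + 1`). -/
abbrev Path (N : ℕ) : Type := ℕ → UnitBall N

/-- The countable product of the normalised Lebesgue measures. -/
def pathMeasure (N : ℕ) : Measure (Path N) :=
  Measure.infinitePi fun _ : ℕ => stepMeasure N

/-- The ball walk in `D` with parameter `ε`, started at `x₀`: each step moves the current
position `x` to `x + min ε (dist (x, ∂D)) • w` with the fresh sample `w` of the unit ball. -/
def walk {N : ℕ} (D : Set (EuclideanSpace ℝ (Fin N))) (ε : ℝ) (x₀ : EuclideanSpace ℝ (Fin N))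
    (ω : Path N) : ℕ → EuclideanSpace ℝ (Fin N)
  | 0 => x₀
  | n + 1 => walk D ε x₀ ω n +
      min ε (Metric.infDist (walk D ε x₀ ω n) (frontier D)) • (ω n : EuclideanSpace ℝ (Fin N))

/-- The pathwise limit of the ball walk. For bounded open `D ⊆ ℝ^N`, `N ≥ 1`, and `x₀ ∈ D`, almost
every path converges, and its limit lies on the boundary of `D`; on the remaining null set of
paths the value is of no importance. -/
def exitPosition {N : ℕ} (D : Set (EuclideanSpace ℝ (Fin N))) (ε : ℝ)
    (x₀ : EuclideanSpace ℝ (Fin N)) (ω : Path N) : EuclideanSpace ℝ (Fin N) :=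
  limUnder atTop (walk D ε x₀ ω)

/-- The value of the ball walk started at `x₀`: the expectation of the boundary data at the limit
position. Only the values of `F` on the boundary of `D` matter. -/
def value {N : ℕ} (D : Set (EuclideanSpace ℝ (Fin N))) (F : EuclideanSpace ℝ (Fin N) → ℝ) (ε : ℝ)
    (x₀ : EuclideanSpace ℝ (Fin N)) : ℝ :=
  ∫ ω, F (exitPosition D ε x₀ ω) ∂(pathMeasure N)

end

end BallWalk

/-! Conditioning on the first step gives `value_eq_integral`: at distance at least `ε` from the
boundary, the value function equals its average over the ball of radius `ε`. This holds only at the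
scale `ε`, so regularity has to come from the limit.

Let `A_t f (x)` be the integral of `f (x + t w) - f x` against a radial weight in `w`. By symmetry
`A_t` is self-adjoint (`integral_mul_integral_difference`). For a `C²` test function `φ`, `A_t φ /
t²` is bounded and tends to a positive multiple of `Δφ` (`tendsto_integral_difference`). For small
`ε k` the averages `A_{ε k} (v k)` vanish on the support of `φ`, hence `∫ v k * A_{ε k} φ = 0`.
Dividing by `(ε k)²` and using dominated convergence gives `∫ u * Δφ = 0`, so `u` is harmonic in the
sense of distributions.

Weyl's lemma then applies. The derivative in `s` of a smooth radial kernel of radius `s` is a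
multiple of the Laplacian of a compactly supported radial function (`hasDerivAt_kernel`). Kernel
averages of `u` around a point are therefore independent of `s`, and letting `s → 0` identifies them
with a multiple of the value at the centre. Locally `u` is thus a multiple of its own mollification,
hence `C²`, and its averages of type `A_t` vanish, so the limit of `A_t / t²` shows `Δu = 0`.

That the walk converges to the boundary rests on martingale convergence (`ae_tendsto_exitPosition`).
-/

namespace BallWalk

variable {N : ℕ}

local notation "E" N => EuclideanSpace ℝ (Fin N)

/-! ### The ball walk: first-step decomposition and almost sure convergence to the boundary. -/

section Walk

/-- The path that starts with the step `w` and continues with `ω`. -/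
def consPath (p : UnitBall N × Path N) : Path N
  | 0 => p.1
  | n + 1 => p.2 n

theorem measurable_consPath : Measurable (consPath (N := N)) := by
  refine measurable_pi_lambda _ fun n => ?_
  cases n with
  | zero => exact measurable_fst
  | succ n => exact (measurable_pi_apply n).comp measurable_snd

instance pathMeasure_isProbabilityMeasure : IsProbabilityMeasure (pathMeasure N) := by
  unfold pathMeasure; infer_instance

/-- Product measures are determined by finite boxes. Padding the index set to an initial segment of
`ℕ` makes the preimage of a box a product of its first side and a shifted box. This is the source of
the Markov property. -/
theorem map_consPath :
    ((stepMeasure N).prod (pathMeasure N)).map consPath = pathMeasure N := by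
  refine Measure.eq_infinitePi _ fun s t ht => ?_
  classical
  obtain ⟨n, hn⟩ : ∃ n, s ⊆ Finset.range (n + 1) := by
    obtain ⟨n, hn⟩ := s.exists_nat_subset_range
    exact ⟨n, hn.trans (Finset.range_mono n.le_succ)⟩
  set t' : ℕ → Set (UnitBall N) := fun i => if i ∈ s then t i else Set.univ with ht'
  have hpi : Set.pi (s : Set ℕ) t = Set.pi (Finset.range (n + 1) : Set ℕ) t' := by
    ext ω
    simp only [Set.mem_pi, ht', Finset.mem_coe]
    constructor
    · intro h i _
      split_ifs with his
      · exact h i his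
      · trivial
    · intro h i his
      have := h i (hn his)
      rwa [if_pos his] at this
  have hmeas : ∀ i, MeasurableSet (t' i) := fun i => by
    simp only [ht']; split_ifs with his
    · exact ht i
    · exact MeasurableSet.univ
  have hprod : ∏ i ∈ s, stepMeasure N (t i) = ∏ i ∈ Finset.range (n + 1), stepMeasure N (t' i) := by
    rw [← Finset.prod_subset hn]
    · exact Finset.prod_congr rfl fun i hi => by simp [ht', hi]
    · intro i _ hi
      simp [ht', hi]
  have hpre : consPath ⁻¹' (Set.pi (Finset.range (n + 1) : Set ℕ) t') =
      t' 0 ×ˢ Set.pi (Finset.range n : Set ℕ) (fun i => t' (i + 1)) := by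
    ext p
    simp only [Set.mem_preimage, Set.mem_pi, Set.mem_prod, Finset.mem_coe, Finset.mem_range]
    constructor
    · intro h
      exact ⟨h 0 n.succ_pos, fun i hi => h (i + 1) (Nat.succ_lt_succ hi)⟩
    · rintro ⟨h0, h⟩ i hi
      cases i with
      | zero => exact h0
      | succ i => exact h i (Nat.lt_of_succ_lt_succ hi)
  rw [hpi, hprod, Measure.map_apply measurable_consPath
    (MeasurableSet.pi (Finset.countable_toSet _) fun i _ => hmeas i), hpre, Measure.prod_prod,
    pathMeasure, Measure.infinitePi_pi _ (fun i _ => hmeas _), Finset.prod_range_succ', mul_comm]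

/-- One step of the walk. -/
noncomputable def step (D : Set (E N)) (ε : ℝ) (x w : E N) : E N :=
  x + min ε (Metric.infDist x (frontier D)) • w

theorem walk_succ (D : Set (E N)) (ε : ℝ) (x : E N) (ω : Path N) (n : ℕ) :
    walk D ε x ω (n + 1) = step D ε (walk D ε x ω n) (ω n) := rfl

theorem walk_consPath (D : Set (E N)) (ε : ℝ) (x : E N) (p : UnitBall N × Path N) (n : ℕ) :
    walk D ε x (consPath p) (n + 1) = walk D ε (step D ε x p.1) p.2 n := by
  induction n with
  | zero => rfl
  | succ n ih => rw [walk_succ, ih]; rfl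

theorem continuous_step (D : Set (E N)) (ε : ℝ) :
    Continuous fun q : (E N) × (E N) => step D ε q.1 q.2 := by
  unfold step
  have := Metric.continuous_infDist_pt (frontier D)
  fun_prop

theorem continuous_walk (D : Set (E N)) (ε : ℝ) (n : ℕ) :
    Continuous fun q : (E N) × Path N => walk D ε q.1 q.2 n := by
  induction n with
  | zero => exact continuous_fst
  | succ n ih =>
    have h2 : Continuous fun q : (E N) × Path N => ((q.2 n : UnitBall N) : E N) :=
      continuous_subtype_val.comp ((continuous_apply n).comp continuous_snd)
    exact (continuous_step D ε).comp (ih.prodMk h2)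

theorem measurable_walk (D : Set (E N)) (ε : ℝ) (x : E N) (n : ℕ) :
    Measurable fun ω : Path N => walk D ε x ω n :=
  ((continuous_walk D ε n).comp (Continuous.prodMk_right x)).measurable

/-- The ball is connected and misses the frontier, so it cannot meet both `D` and the complement of
its closure. -/
theorem ball_infDist_frontier_subset {D : Set (E N)} (hD : IsOpen D) {x : E N} (hx : x ∈ D) :
    Metric.ball x (Metric.infDist x (frontier D)) ⊆ D := by
  by_cases hr : 0 < Metric.infDist x (frontier D)
  · refine (convex_ball x _).isPreconnected.subset_left_of_subset_union hD
      isClosed_closure.isOpen_compl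
      (Set.disjoint_compl_right_iff_subset.mpr subset_closure) (fun y hy => ?_)
      ⟨x, Metric.mem_ball_self hr, hx⟩
    have hyf : y ∉ frontier D := Set.disjoint_left.mp Metric.disjoint_ball_infDist hy
    rw [hD.frontier_eq] at hyf
    by_cases hyD : y ∈ D
    · exact Or.inl hyD
    · exact Or.inr fun hyc => hyf ⟨hyc, hyD⟩
  -- This case also covers an empty frontier, where `infDist` takes the default value `0`.
  · rw [Metric.ball_eq_empty.mpr (not_lt.mp hr)]
    exact Set.empty_subset _

theorem step_mem {D : Set (E N)} (hD : IsOpen D) {ε : ℝ} (hε : 0 ≤ ε) {x : E N} (hx : x ∈ D)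
    {w : E N} (hw : ‖w‖ < 1) : step D ε x w ∈ D := by
  set d := Metric.infDist x (frontier D) with hd
  have hd0 : 0 ≤ d := Metric.infDist_nonneg
  rcases hd0.eq_or_lt with h0 | h0
  · simpa [step, ← hd, ← h0, hε] using hx
  · refine ball_infDist_frontier_subset hD hx ?_
    rw [Metric.mem_ball, dist_eq_norm, step, add_sub_cancel_left, norm_smul, ← hd,
      Real.norm_of_nonneg (le_min hε hd0)]
    calc min ε d * ‖w‖ ≤ d * ‖w‖ := by gcongr; exact min_le_right _ _
      _ < d * 1 := by gcongr
      _ = d := mul_one d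

theorem norm_coe_lt_one (w : UnitBall N) : ‖(w : E N)‖ < 1 := mem_ball_zero_iff.mp w.2

theorem walk_mem {D : Set (E N)} (hD : IsOpen D) {ε : ℝ} (hε : 0 ≤ ε) {x : E N} (hx : x ∈ D)
    (ω : Path N) (n : ℕ) : walk D ε x ω n ∈ D := by
  induction n with
  | zero => exact hx
  | succ n ih => exact step_mem hD hε ih (norm_coe_lt_one _)

theorem integral_stepMeasure (f : (E N) → ℝ) :
    ∫ w : UnitBall N, f w ∂(stepMeasure N) =
      (volume (Metric.ball (0 : E N) 1)).toReal⁻¹ * ∫ w in Metric.ball (0 : E N) 1, f w := by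
  rw [stepMeasure, integral_smul_measure, smul_eq_mul, ENNReal.toReal_inv,
    integral_subtype_comap Metric.isOpen_ball.measurableSet f]

theorem measurable_coe_eval (n : ℕ) : Measurable fun ω : Path N => (ω n : E N) :=
  measurable_subtype_coe.comp (measurable_pi_apply n)

/-- The filtration generated by the steps. -/
noncomputable def stepFiltration (N : ℕ) :
    Filtration ℕ (inferInstance : MeasurableSpace (Path N)) :=
  Filtration.natural (fun n (ω : Path N) => (ω n : E N))
    fun n => (measurable_coe_eval n).stronglyMeasurable

theorem measurable_stepFiltration_coe {n m : ℕ} (h : n ≤ m) :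
    Measurable[stepFiltration N m] fun ω : Path N => (ω n : E N) :=
  (comap_measurable _).mono (le_iSup₂_of_le n h le_rfl) le_rfl

/-- Position `n + 1` uses the samples `0, …, n`, which is exactly what the natural filtration knows
at time `n`; hence the shift by one. -/
theorem measurable_stepFiltration_walk (D : Set (E N)) (ε : ℝ) (x : E N) (n : ℕ) :
    Measurable[stepFiltration N n] fun ω : Path N => walk D ε x ω (n + 1) := by
  induction n with
  | zero =>
    exact ((continuous_step D ε).measurable.comp measurable_prodMk_left).comp
      (measurable_stepFiltration_coe le_rfl)
  | succ n ih =>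
    have ih' := ih.mono ((stepFiltration N).mono n.le_succ) le_rfl
    exact (continuous_step D ε).measurable.comp
      (ih'.prodMk (measurable_stepFiltration_coe le_rfl))

theorem integral_coe_stepMeasure (i : Fin N) :
    ∫ w : UnitBall N, (w : E N) i ∂(stepMeasure N) = 0 := by
  rw [integral_stepMeasure fun w => w i]
  have h : ∫ w in Metric.ball (0 : E N) 1, w i = - ∫ w in Metric.ball (0 : E N) 1, w i := by
    rw [← integral_indicator Metric.isOpen_ball.measurableSet, ← integral_neg,
      ← integral_neg_eq_self]
    refine integral_congr_ae (ae_of_all _ fun w => ?_)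
    by_cases hw : w ∈ Metric.ball (0 : E N) 1
    · have hw' : -w ∈ Metric.ball (0 : E N) 1 := by simpa using hw
      simp [Set.indicator_of_mem hw, Set.indicator_of_mem hw']
    · have hw' : -w ∉ Metric.ball (0 : E N) 1 := by simpa using hw
      simp [Set.indicator_of_notMem hw, Set.indicator_of_notMem hw']
  rw [show ∫ w in Metric.ball (0 : E N) 1, w i = 0 by linarith, mul_zero]

theorem indep_step (n : ℕ) :
    ProbabilityTheory.Indep
      (MeasurableSpace.comap (fun ω : Path N => (ω (n + 1) : E N)) inferInstance)
      (stepFiltration N n) (pathMeasure N) :=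
  ProbabilityTheory.iIndepFun.indep_comap_natural_of_lt _
    (ProbabilityTheory.iIndepFun_infinitePi (fun _ => measurable_subtype_coe)) n.lt_succ_self

theorem condExp_step (n : ℕ) (i : Fin N) :
    (pathMeasure N)[fun ω : Path N => (ω (n + 1) : E N) i | stepFiltration N n]
      =ᵐ[pathMeasure N] fun _ => 0 := by
  have hc : Continuous fun w : E N => w i := by fun_prop
  have h := condExp_indep_eq (measurable_coe_eval (N := N) (n + 1)).comap_le
    ((stepFiltration N).le n)
    (hc.measurable.comp (comap_measurable _)).stronglyMeasurable (indep_step n)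
  refine h.trans (ae_of_all _ fun _ => ?_)
  have hm : Measurable fun w : UnitBall N => (w : E N) i :=
    hc.measurable.comp measurable_subtype_coe
  change ∫ ω : Path N, (ω (n + 1) : E N) i ∂(pathMeasure N) = 0
  have hmap := integral_map (μ := pathMeasure N) (measurable_pi_apply (n + 1)).aemeasurable
    hm.aestronglyMeasurable
  rw [pathMeasure, Measure.infinitePi_map_eval, integral_coe_stepMeasure] at hmap
  exact hmap.symm

theorem abs_coord_le (v : E N) (i : Fin N) : |v i| ≤ ‖v‖ := by
  simpa using PiLp.norm_apply_le v i

/-- Each increment is a step length known from the past times a fresh centred sample, so its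
conditional expectation vanishes. -/
theorem martingale_walk {D : Set (E N)} (hD : IsOpen D) {R : ℝ} (hR : ∀ y ∈ D, ‖y‖ ≤ R) {ε : ℝ}
    (hε : 0 ≤ ε) {x : E N} (hx : x ∈ D) (i : Fin N) :
    Martingale (fun n (ω : Path N) => walk D ε x ω (n + 1) i) (stepFiltration N)
      (pathMeasure N) := by
  have hc : Continuous fun w : E N => w i := by fun_prop
  have hint : ∀ n, Integrable (fun ω : Path N => walk D ε x ω (n + 1) i) (pathMeasure N) :=
    fun n => Integrable.of_bound
      (hc.measurable.comp (measurable_walk D ε x (n + 1))).aestronglyMeasurable R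
      (ae_of_all _ fun ω => (abs_coord_le _ i).trans (hR _ (walk_mem hD hε hx ω _)))
  refine martingale_of_condExp_sub_eq_zero_nat
    (fun n => (hc.measurable.comp (measurable_stepFiltration_walk D ε x n)).stronglyMeasurable)
    hint fun n => ?_
  set r : Path N → ℝ := fun ω => min ε (Metric.infDist (walk D ε x ω (n + 1)) (frontier D))
  have hr : StronglyMeasurable[stepFiltration N n] r :=
    ((continuous_const.min (Metric.continuous_infDist_pt (frontier D))).measurable.comp
      (measurable_stepFiltration_walk D ε x n)).stronglyMeasurable
  have heq : (fun ω : Path N => walk D ε x ω (n + 1 + 1) i) - (fun ω => walk D ε x ω (n + 1) i)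
      = r * fun ω => (ω (n + 1) : E N) i := by
    funext ω
    simp [walk, r]
  have hw : Integrable (fun ω : Path N => (ω (n + 1) : E N) i) (pathMeasure N) :=
    Integrable.of_bound (hc.measurable.comp (measurable_coe_eval (n + 1))).aestronglyMeasurable 1
      (ae_of_all _ fun ω => (abs_coord_le _ i).trans (norm_coe_lt_one _).le)
  have hrw : Integrable (r * fun ω : Path N => (ω (n + 1) : E N) i) (pathMeasure N) := by
    rw [← heq]; exact (hint (n + 1)).sub (hint n)
  rw [heq]
  filter_upwards [condExp_mul_of_stronglyMeasurable_left hr hrw hw, condExp_step n i] with ω h1 h2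
  rw [h1, Pi.mul_apply, h2, mul_zero, Pi.zero_apply]

theorem ae_exists_tendsto_walk {D : Set (E N)} (hD : IsOpen D) (hb : Bornology.IsBounded D)
    {ε : ℝ} (hε : 0 ≤ ε) {x : E N} (hx : x ∈ D) :
    ∀ᵐ ω ∂(pathMeasure N), ∃ y, Tendsto (walk D ε x ω) atTop (𝓝 y) := by
  obtain ⟨R, hR⟩ := hb.exists_norm_le
  have hR0 : 0 ≤ R := (norm_nonneg x).trans (hR x hx)
  have h : ∀ i : Fin N, ∀ᵐ ω ∂(pathMeasure N),
      ∃ c, Tendsto (fun n => walk D ε x ω (n + 1) i) atTop (𝓝 c) := by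
    intro i
    refine (martingale_walk hD hR hε hx i).submartingale.exists_ae_tendsto_of_bdd
      (R := R.toNNReal) fun n => ?_
    refine (eLpNorm_le_of_ae_bound (C := R) (ae_of_all _ fun ω =>
      (abs_coord_le _ i).trans (hR _ (walk_mem hD hε hx ω _)))).trans ?_
    simp [ENNReal.ofReal]
  filter_upwards [ae_all_iff.mpr h] with ω hω
  choose c hc using hω
  refine ⟨WithLp.toLp 2 c, (tendsto_add_atTop_iff_nat 1).mp ?_⟩
  have h1 : Tendsto (fun n => WithLp.ofLp (walk D ε x ω (n + 1))) atTop (𝓝 c) :=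
    tendsto_pi_nhds.mpr hc
  exact ((PiLp.continuous_toLp 2 _).tendsto c).comp h1

/-- By scaling, the half ball carries the fraction `2⁻ᴺ` of the volume. -/
theorem stepMeasure_small_lt_one (hN : 1 ≤ N) :
    stepMeasure N {w : UnitBall N | ‖(w : E N)‖ < 1 / 2} < 1 := by
  rw [stepMeasure_apply]
  have himg : (Subtype.val '' {w : UnitBall N | ‖(w : E N)‖ < 1 / 2}) =
      Metric.ball (0 : E N) (1 / 2) := by
    ext v
    simp only [Set.mem_image, Set.mem_ofPred_eq, Subtype.exists, exists_and_right,
      mem_ball_zero_iff]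
    constructor
    · rintro ⟨w, ⟨_, hw⟩, rfl⟩; exact hw
    · intro h; exact ⟨v, ⟨by linarith, h⟩, rfl⟩
  have : Nonempty (Fin N) := ⟨⟨0, hN⟩⟩
  have hpos : (0 : ENNReal) < volume (Metric.ball (0 : E N) 1) :=
    Metric.measure_ball_pos volume _ one_pos
  rw [himg, ENNReal.div_lt_iff (Or.inl hpos.ne') (Or.inl measure_ball_lt_top.ne), one_mul,
    Measure.addHaar_ball volume (0 : E N) (by norm_num : (0 : ℝ) ≤ 1 / 2)]
  conv_rhs => rw [← one_mul (volume (Metric.ball (0 : E N) 1))]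
  refine ENNReal.mul_lt_mul_left hpos.ne' measure_ball_lt_top.ne ?_
  rw [ENNReal.ofReal_lt_one, finrank_euclideanSpace_fin]
  exact pow_lt_one₀ (by norm_num) (by norm_num) (by omega)

/-- Convergence to zero would confine all samples from some time on to the half ball. By
independence this has probability at most `q ^ k` for every `k`, with `q < 1`. -/
theorem ae_not_tendsto_step (hN : 1 ≤ N) :
    ∀ᵐ ω ∂(pathMeasure N), ¬ Tendsto (fun n => ‖(ω n : E N)‖) atTop (𝓝 0) := by
  set A : Set (UnitBall N) := {w | ‖(w : E N)‖ < 1 / 2} with hA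
  have hAm : MeasurableSet A :=
    (isOpen_lt (continuous_norm.comp continuous_subtype_val) continuous_const).measurableSet
  have hnull : ∀ m : ℕ, pathMeasure N (Set.pi (Set.Ici m) fun _ => A) = 0 := by
    intro m
    refine le_antisymm (ge_of_tendsto' (ENNReal.tendsto_pow_atTop_nhds_zero_of_lt_one
      (stepMeasure_small_lt_one hN)) fun k => ?_) zero_le
    calc pathMeasure N (Set.pi (Set.Ici m) fun _ => A)
        ≤ pathMeasure N (Set.pi (Finset.Ico m (m + k) : Finset ℕ) fun _ => A) :=
          measure_mono fun ω hω i hi => hω i (Finset.mem_Ico.mp hi).1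
      _ = stepMeasure N A ^ k := by
          rw [pathMeasure, Measure.infinitePi_pi _ (fun _ _ => hAm)]
          simp
  have hall : ∀ᵐ ω ∂(pathMeasure N), ∀ m, ω ∉ Set.pi (Set.Ici m) fun _ => A :=
    ae_all_iff.mpr fun m => measure_eq_zero_iff_ae_notMem.mp (hnull m)
  filter_upwards [hall] with ω hω ht
  obtain ⟨m, hm⟩ := eventually_atTop.mp (ht.eventually (gt_mem_nhds (by norm_num : (0 : ℝ) < 1 / 2)))
  exact hω m fun i hi => hm i hi

theorem frontier_nonempty (hN : 1 ≤ N) {D : Set (E N)} (hne : D.Nonempty)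
    (hb : Bornology.IsBounded D) : (frontier D).Nonempty := by
  have : Nonempty (Fin N) := ⟨⟨0, hN⟩⟩
  refine nonempty_frontier_iff.mpr ⟨hne, ?_⟩
  rintro rfl
  exact NormedSpace.unbounded_univ ℝ (E N) hb

/-- At a limit off the frontier the step lengths would have a positive limit. Since the increments
tend to zero, so would the samples, which is excluded almost surely. -/
theorem ae_tendsto_exitPosition (hN : 1 ≤ N) {D : Set (E N)} (hD : IsOpen D)
    (hb : Bornology.IsBounded D) {ε : ℝ} (hε : 0 < ε) {x : E N} (hx : x ∈ D) :
    ∀ᵐ ω ∂(pathMeasure N), Tendsto (walk D ε x ω) atTop (𝓝 (exitPosition D ε x ω)) ∧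
      exitPosition D ε x ω ∈ frontier D := by
  filter_upwards [ae_exists_tendsto_walk hD hb hε.le hx, ae_not_tendsto_step hN] with ω hω hs
  have ht : Tendsto (walk D ε x ω) atTop (𝓝 (exitPosition D ε x ω)) := tendsto_nhds_limUnder hω
  refine ⟨ht, ?_⟩
  set y := exitPosition D ε x ω
  rw [isClosed_frontier.mem_iff_infDist_zero (frontier_nonempty hN ⟨x, hx⟩ hb)]
  by_contra hne
  have hpos : 0 < Metric.infDist y (frontier D) :=
    lt_of_le_of_ne Metric.infDist_nonneg (Ne.symm hne)
  have hr : Tendsto (fun n => min ε (Metric.infDist (walk D ε x ω n) (frontier D))) atTop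
      (𝓝 (min ε (Metric.infDist y (frontier D)))) :=
    tendsto_const_nhds.min (((Metric.continuous_infDist_pt (frontier D)).tendsto y).comp ht)
  have hd : Tendsto (fun n => walk D ε x ω (n + 1) - walk D ε x ω n) atTop (𝓝 0) := by
    simpa using ((tendsto_add_atTop_iff_nat 1).mpr ht).sub ht
  have hq := hd.norm.div hr (lt_min hε hpos).ne'
  rw [norm_zero, zero_div] at hq
  refine hs (hq.congr' ?_)
  filter_upwards [hr.eventually (lt_mem_nhds (lt_min hε hpos))] with n hn
  simp only [Pi.div_apply, walk, add_sub_cancel_left, norm_smul, Real.norm_of_nonneg hn.le]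
  rw [mul_div_cancel_left₀ _ hn.ne']

end Walk

/-! ### Value functions: bounds, measurability and the mean value property at scale `ε`. -/

section Value

/-- Tietze extension from the compact frontier. It allows the boundary data to be evaluated at
finite times, before the walk reaches its limit. -/
theorem exists_boundedContinuous_eqOn_frontier {D : Set (E N)} (hb : Bornology.IsBounded D)
    {F : (E N) → ℝ} (hF : ContinuousOn F (frontier D)) :
    ∃ G : BoundedContinuousFunction (E N) ℝ, Set.EqOn G F (frontier D) := by
  have hcomp : IsCompact (frontier D) :=
    hb.isCompact_closure.of_isClosed_subset isClosed_frontier frontier_subset_closure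
  have : CompactSpace (frontier D) := isCompact_iff_compactSpace.mp hcomp
  obtain ⟨G, -, hG⟩ := BoundedContinuousFunction.exists_norm_eq_domRestrict_eq_of_closed
    (BoundedContinuousFunction.mkOfCompact ⟨(frontier D).domRestrict F, hF.domRestrict⟩)
    isClosed_frontier
  exact ⟨G, fun y hy => DFunLike.congr_fun hG ⟨y, hy⟩⟩

/-- The expectation of `G` at the position after `n` steps. -/
noncomputable def meanAt (D : Set (E N)) (G : BoundedContinuousFunction (E N) ℝ) (ε : ℝ) (n : ℕ)
    (x : E N) : ℝ :=
  ∫ ω, G (walk D ε x ω n) ∂(pathMeasure N)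

variable (D : Set (E N)) (G : BoundedContinuousFunction (E N) ℝ) (ε : ℝ)

theorem integrable_walk (n : ℕ) (x : E N) :
    Integrable (fun ω => G (walk D ε x ω n)) (pathMeasure N) :=
  Integrable.of_bound (G.continuous.measurable.comp (measurable_walk D ε x n)).aestronglyMeasurable
    ‖G‖ (ae_of_all _ fun _ => G.norm_coe_le_norm _)

theorem abs_meanAt_le (n : ℕ) (x : E N) : |meanAt D G ε n x| ≤ ‖G‖ := by
  simpa [meanAt] using norm_integral_le_of_norm_le_const (μ := pathMeasure N)
    (ae_of_all _ fun ω => G.norm_coe_le_norm (walk D ε x ω n))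

theorem continuous_meanAt (n : ℕ) : Continuous (meanAt D G ε n) := by
  refine continuous_of_dominated (bound := fun _ => ‖G‖)
    (fun x => (integrable_walk D G ε n x).aestronglyMeasurable)
    (fun x => ae_of_all _ fun _ => G.norm_coe_le_norm _) (integrable_const _)
    (ae_of_all _ fun ω => ?_)
  exact G.continuous.comp ((continuous_walk D ε n).comp (Continuous.prodMk_left ω))

theorem meanAt_succ (n : ℕ) (x : E N) :
    meanAt D G ε (n + 1) x = ∫ w : UnitBall N, meanAt D G ε n (step D ε x w) ∂(stepMeasure N) := by
  have hm : Measurable fun ω : Path N => G (walk D ε x ω (n + 1)) :=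
    G.continuous.measurable.comp (measurable_walk D ε x (n + 1))
  have hint : Integrable (fun p : UnitBall N × Path N => G (walk D ε (step D ε x p.1) p.2 n))
      ((stepMeasure N).prod (pathMeasure N)) := by
    refine Integrable.of_bound ?_ ‖G‖ (ae_of_all _ fun _ => G.norm_coe_le_norm _)
    have := hm.comp measurable_consPath
    simp only [Function.comp_def, walk_consPath] at this
    exact this.aestronglyMeasurable
  rw [meanAt, ← map_consPath, integral_map measurable_consPath.aemeasurable
    hm.aestronglyMeasurable]
  simp only [walk_consPath]
  rw [integral_prod _ hint]
  rfl

variable {D G ε}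

theorem tendsto_meanAt (hN : 1 ≤ N) (hD : IsOpen D) (hb : Bornology.IsBounded D)
    {F : (E N) → ℝ} (hG : Set.EqOn G F (frontier D)) (hε : 0 < ε) {x : E N} (hx : x ∈ D) :
    Tendsto (fun n => meanAt D G ε n x) atTop (𝓝 (value D F ε x)) := by
  refine tendsto_integral_of_dominated_convergence (fun _ => ‖G‖)
    (fun n => (integrable_walk D G ε n x).aestronglyMeasurable) (integrable_const _)
    (fun n => ae_of_all _ fun _ => G.norm_coe_le_norm _) ?_
  filter_upwards [ae_tendsto_exitPosition hN hD hb hε hx] with ω hω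
  rw [← hG hω.2]
  exact (G.continuous.tendsto _).comp hω.1

theorem abs_value_le (hN : 1 ≤ N) (hD : IsOpen D) (hb : Bornology.IsBounded D)
    {F : (E N) → ℝ} (hG : Set.EqOn G F (frontier D)) (hε : 0 < ε) {x : E N} (hx : x ∈ D) :
    |value D F ε x| ≤ ‖G‖ :=
  le_of_tendsto' (tendsto_meanAt hN hD hb hG hε hx).abs fun n => abs_meanAt_le D G ε n x

/-- On `D` the value is a pointwise limit of the continuous functions `meanAt`; no continuity of the
value itself is needed. -/
theorem measurable_indicator_value (hN : 1 ≤ N) (hD : IsOpen D) (hb : Bornology.IsBounded D)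
    {F : (E N) → ℝ} (hG : Set.EqOn G F (frontier D)) (hε : 0 < ε) :
    Measurable (D.indicator (value D F ε)) := by
  refine measurable_of_tendsto_metrizable (f := fun n => D.indicator (meanAt D G ε n))
    (fun n => (continuous_meanAt D G ε n).measurable.indicator hD.measurableSet)
    (tendsto_pi_nhds.mpr fun x => ?_)
  by_cases hx : x ∈ D
  · simpa [hx] using tendsto_meanAt hN hD hb hG hε hx
  · simp [hx]

theorem value_eq_integral (hN : 1 ≤ N) (hD : IsOpen D) (hb : Bornology.IsBounded D)
    {F : (E N) → ℝ} (hG : Set.EqOn G F (frontier D)) (hε : 0 < ε) {x : E N} (hx : x ∈ D) :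
    value D F ε x = ∫ w : UnitBall N, value D F ε (step D ε x w) ∂(stepMeasure N) := by
  refine tendsto_nhds_unique ((tendsto_add_atTop_iff_nat 1).mpr
    (tendsto_meanAt hN hD hb hG hε hx)) ?_
  simp only [meanAt_succ]
  refine tendsto_integral_of_dominated_convergence (fun _ => ‖G‖) (fun n => ?_)
    (integrable_const _) (fun n => ae_of_all _ fun _ => abs_meanAt_le D G ε n _)
    (ae_of_all _ fun w => tendsto_meanAt hN hD hb hG hε
      (step_mem hD hε.le hx (norm_coe_lt_one w)))
  exact ((continuous_meanAt D G ε n).comp ((continuous_step D ε).comp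
    ((Continuous.prodMk_right x).comp continuous_subtype_val))).aestronglyMeasurable

/-- Far from the boundary, the value function has the mean value property over balls of
radius `ε`. -/
theorem indicator_value_eq_average (hN : 1 ≤ N) (hD : IsOpen D) (hb : Bornology.IsBounded D)
    {F : (E N) → ℝ} (hG : Set.EqOn G F (frontier D)) (hε : 0 < ε) {x : E N} (hx : x ∈ D)
    (hd : ε ≤ Metric.infDist x (frontier D)) :
    ∫ w in Metric.ball (0 : E N) 1,
        (D.indicator (value D F ε) (x + ε • w) - D.indicator (value D F ε) x) = 0 := by
  set v := D.indicator (value D F ε)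
  have hvm : Measurable v := measurable_indicator_value hN hD hb hG hε
  have hvb : ∀ z, ‖v z‖ ≤ ‖G‖ := fun z => by
    by_cases hz : z ∈ D
    · simpa [v, hz] using abs_value_le hN hD hb hG hε hz
    · simp [v, hz]
  have hstep : ∀ w, step D ε x w = x + ε • w := fun w => by rw [step, min_eq_left hd]
  have h : v x = ∫ w : UnitBall N, v (x + ε • (w : E N)) ∂(stepMeasure N) := by
    simp only [v, Set.indicator_of_mem hx]
    rw [value_eq_integral hN hD hb hG hε hx]
    refine integral_congr_ae (ae_of_all _ fun w => ?_)
    have := step_mem hD hε.le hx (norm_coe_lt_one w)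
    simp only [hstep] at this ⊢
    rw [Set.indicator_of_mem this]
  rw [integral_stepMeasure fun w => v (x + ε • w)] at h
  have hvol : (volume (Metric.ball (0 : E N) 1)).toReal ≠ 0 :=
    (ENNReal.toReal_pos (Metric.measure_ball_pos volume _ one_pos).ne'
      measure_ball_lt_top.ne).ne'
  have : IsFiniteMeasure (volume.restrict (Metric.ball (0 : E N) 1)) :=
    ⟨by simpa using measure_ball_lt_top⟩
  have hi : Integrable (fun w => v (x + ε • w)) (volume.restrict (Metric.ball (0 : E N) 1)) :=
    Integrable.of_bound (hvm.comp (by fun_prop)).aestronglyMeasurable ‖G‖ (ae_of_all _ fun _ => hvb _)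
  rw [integral_sub hi (integrable_const _), integral_const, smul_eq_mul]
  have h2 := congrArg (fun t => (volume (Metric.ball (0 : E N) 1)).toReal * t) h
  rw [mul_inv_cancel_left₀ hvol] at h2
  simp only [Measure.real, Measure.restrict_apply_univ]
  linarith

end Value

/-! ### Radial weights and their second moments. -/

/-- A nonnegative integrable weight which is invariant under linear isometries, positive on the open
unit ball, and zero outside it. -/
structure IsRadialWeight (ρ : (E N) → ℝ) : Prop where
  integrable : Integrable ρ
  nonneg : ∀ w, 0 ≤ ρ w
  eq_zero : ∀ w, 1 ≤ ‖w‖ → ρ w = 0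
  pos : ∀ w, ‖w‖ < 1 → 0 < ρ w
  map_eq : ∀ (L : (E N) ≃ₗᵢ[ℝ] (E N)) (w), ρ (L w) = ρ w

namespace IsRadialWeight

variable {ρ : (E N) → ℝ} (hρ : IsRadialWeight ρ)

include hρ

theorem neg (w : E N) : ρ (-w) = ρ w := hρ.map_eq (LinearIsometryEquiv.neg ℝ) w

theorem integral_comp_isometry (L : (E N) ≃ₗᵢ[ℝ] (E N)) (f : (E N) → ℝ) :
    ∫ w, ρ w * f (L w) = ∫ w, ρ w * f w := by
  rw [← L.measurePreserving.integral_comp L.toHomeomorph.measurableEmbedding fun w => ρ w * f w]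
  simp only [hρ.map_eq L]

theorem integrable_mul {f : (E N) → ℝ} (hf : Continuous f) : Integrable fun w => ρ w * f w := by
  obtain ⟨C, hC⟩ := (isCompact_closedBall (0 : E N) 1).exists_bound_of_continuousOn hf.continuousOn
  refine (hρ.integrable.norm.const_mul C).mono'
    (hρ.integrable.aestronglyMeasurable.mul hf.aestronglyMeasurable) (ae_of_all _ fun w => ?_)
  rw [norm_mul, mul_comm]
  by_cases hw : 1 ≤ ‖w‖
  · simp [hρ.eq_zero w hw]
  · exact mul_le_mul_of_nonneg_right (hC w (by simpa using (not_le.mp hw).le)) (norm_nonneg _)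

/-- Reflecting the `i`-th coordinate changes the sign of the integrand. -/
theorem integral_coord_mul_coord {i j : Fin N} (hij : i ≠ j) : ∫ w, ρ w * (w i * w j) = 0 := by
  have h := hρ.integral_comp_isometry (LinearIsometryEquiv.piLpCongrRight 2 fun k : Fin N =>
    if k = i then LinearIsometryEquiv.neg ℝ else LinearIsometryEquiv.refl ℝ ℝ) fun w => w i * w j
  have hL : ∀ w : E N, ρ w * ((LinearIsometryEquiv.piLpCongrRight 2 fun k : Fin N =>
      if k = i then LinearIsometryEquiv.neg ℝ else LinearIsometryEquiv.refl ℝ ℝ) w i *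
      (LinearIsometryEquiv.piLpCongrRight 2 fun k : Fin N =>
      if k = i then LinearIsometryEquiv.neg ℝ else LinearIsometryEquiv.refl ℝ ℝ) w j) =
      -(ρ w * (w i * w j)) := fun w => by
    simp [LinearIsometryEquiv.piLpCongrRight_apply, hij.symm]
  simp only [hL, integral_neg] at h
  linarith

theorem integral_coord_sq (i j : Fin N) :
    ∫ w, ρ w * (w i * w i) = ∫ w, ρ w * (w j * w j) := by
  have h := hρ.integral_comp_isometry
    (LinearIsometryEquiv.piLpCongrLeft 2 ℝ ℝ (Equiv.swap i j)) fun w => w j * w j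
  simpa [LinearIsometryEquiv.piLpCongrLeft_apply] using h

theorem integral_coord_sq_pos (i : Fin N) : 0 < ∫ w, ρ w * (w i * w i) := by
  have hc : Continuous fun w : E N => w i := by fun_prop
  rw [integral_pos_iff_support_of_nonneg
    (fun w => mul_nonneg (hρ.nonneg w) (mul_self_nonneg _)) (hρ.integrable_mul (hc.mul hc))]
  have ho : IsOpen (Metric.ball (0 : E N) 1 ∩ {w | w i ≠ 0}) :=
    Metric.isOpen_ball.inter (isOpen_ne_fun hc continuous_const)
  refine (ho.measure_pos volume ⟨EuclideanSpace.single i (1 / 2 : ℝ), ?_, ?_⟩).trans_le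
    (measure_mono ?_)
  · simp; norm_num
  · simp
  · rintro w ⟨hw, hwi⟩
    exact (mul_pos (hρ.pos w (by simpa using hw)) (mul_self_pos.mpr hwi)).ne'

/-- The second-moment matrix is a multiple of the identity, so only the trace of `B` survives. With
`B` a Hessian this produces the Laplacian. -/
theorem integral_bilinear (i : Fin N) (B : (E N) →L[ℝ] (E N) →L[ℝ] ℝ) :
    ∫ w, ρ w * B w w = (∫ w, ρ w * (w i * w i)) *
      ∑ k, B (EuclideanSpace.basisFun (Fin N) ℝ k) (EuclideanSpace.basisFun (Fin N) ℝ k) := by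
  set e := EuclideanSpace.basisFun (Fin N) ℝ
  have hB : ∀ w : E N, ρ w * B w w = ∑ k, ∑ l, (ρ w * (w k * w l)) * B (e k) (e l) := fun w => by
    have hw : w = ∑ k, w k • e k := by
      simpa [e] using (e.sum_repr w).symm
    conv_lhs => rw [hw]
    simp only [map_sum, map_smul, sum_apply, smul_apply,
      Finset.mul_sum, smul_eq_mul]
    rw [Finset.sum_comm]
    refine Finset.sum_congr rfl fun k _ => Finset.sum_congr rfl fun l _ => by rw [← hw]; ring
  have hi : ∀ k l, Integrable fun w => (ρ w * (w k * w l)) * B (e k) (e l) := fun k l =>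
    (hρ.integrable_mul (f := fun w => w k * w l) (by fun_prop)).mul_const _
  simp only [hB]
  rw [integral_finsetSum _ fun k _ => integrable_finsetSum _ fun l _ => hi k l, Finset.mul_sum]
  refine Finset.sum_congr rfl fun k _ => ?_
  rw [integral_finsetSum _ fun l _ => hi k l, Finset.sum_eq_single k]
  · rw [integral_mul_const, hρ.integral_coord_sq k i]
  · intro l _ hl
    rw [integral_mul_const, hρ.integral_coord_mul_coord hl.symm, zero_mul]
  · simp

end IsRadialWeight

theorem laplacian_eq_sum (φ : (E N) → ℝ) (z : E N) :
    Laplacian.laplacian φ z = ∑ k, fderiv ℝ (fderiv ℝ φ) z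
      (EuclideanSpace.basisFun (Fin N) ℝ k) (EuclideanSpace.basisFun (Fin N) ℝ k) := by
  rw [InnerProductSpace.laplacian_eq_iteratedFDeriv_orthonormalBasis φ
    (EuclideanSpace.basisFun (Fin N) ℝ)]
  simp [iteratedFDeriv_two_apply]

/-! ### Symmetric second differences of `C²` functions. -/

section SecondDifference

variable {V : Type*} [NormedAddCommGroup V] [NormedSpace ℝ V] {φ : V → ℝ}

theorem hasDerivAt_symm_sum (hφ : ContDiff ℝ 2 φ) (z h : V) (t : ℝ) :
    HasDerivAt (fun s : ℝ => φ (z + s • h) + φ (z - s • h) - 2 * φ z)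
      (fderiv ℝ φ (z + t • h) h - fderiv ℝ φ (z - t • h) h) t := by
  have hd : Differentiable ℝ φ := hφ.differentiable (by norm_num)
  have hl : HasDerivAt (fun s : ℝ => s • h) h t := by simpa using (hasDerivAt_id t).smul_const h
  have h1 := (hd (z + t • h)).hasFDerivAt.comp_hasDerivAt t (hl.const_add z)
  have h2 := (hd (z - t • h)).hasFDerivAt.comp_hasDerivAt t (hl.const_sub z)
  simpa [sub_eq_add_neg] using (h1.add h2).sub_const (2 * φ z)

theorem exists_second_difference_bound (hφ : ContDiff ℝ 2 φ) (hc : HasCompactSupport φ) :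
    ∃ C : ℝ, 0 ≤ C ∧ ∀ z h, |φ (z + h) + φ (z - h) - 2 * φ z| ≤ C * ‖h‖ ^ 2 := by
  obtain ⟨K, hK⟩ := (hφ.fderiv_right (m := 1) (by norm_num)).lipschitzWith_of_hasCompactSupport
    (hc.fderiv ℝ) (by norm_num)
  refine ⟨2 * K, by positivity, fun z h => ?_⟩
  have key := norm_image_sub_le_of_norm_deriv_le_segment_01'
    (f := fun s : ℝ => φ (z + s • h) + φ (z - s • h) - 2 * φ z) (C := 2 * K * ‖h‖ ^ 2)
    (fun t _ => (hasDerivAt_symm_sum hφ z h t).hasDerivWithinAt) fun t ht => by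
      rw [← sub_apply]
      have h1 := hK.norm_sub_le (z + t • h) (z - t • h)
      have h2 : z + t • h - (z - t • h) = (2 * t) • h := by rw [two_mul, add_smul]; abel
      rw [h2, norm_smul, Real.norm_of_nonneg (by linarith [ht.1])] at h1
      calc _ ≤ ‖fderiv ℝ φ (z + t • h) - fderiv ℝ φ (z - t • h)‖ * ‖h‖ :=
            ContinuousLinearMap.le_opNorm _ _
        _ ≤ (K * (2 * t * ‖h‖)) * ‖h‖ := by gcongr
        _ = (2 * K * ‖h‖ ^ 2) * t := by ring
        _ ≤ (2 * K * ‖h‖ ^ 2) * 1 := by gcongr; exact ht.2.le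
        _ = _ := mul_one _
  simpa [← two_mul] using key

/-- One application of l'Hôpital's rule reduces the claim to a symmetric difference quotient of the
first derivative. -/
theorem tendsto_second_difference (hφ : ContDiff ℝ 2 φ) (z h : V) :
    Tendsto (fun t : ℝ => (φ (z + t • h) + φ (z - t • h) - 2 * φ z) / t ^ 2) (𝓝[>] 0)
      (𝓝 (fderiv ℝ (fderiv ℝ φ) z h h)) := by
  have hd : HasFDerivAt (fderiv ℝ φ) (fderiv ℝ (fderiv ℝ φ) z) z :=
    ((hφ.fderiv_right (m := 1) (by norm_num)).differentiable (by norm_num) z).hasFDerivAt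
  have hl : HasDerivAt (fun s : ℝ => s • h) h 0 := by simpa using (hasDerivAt_id (0 : ℝ)).smul_const h
  have h1 : HasDerivAt (fun t : ℝ => fderiv ℝ φ (z + t • h) h)
      (fderiv ℝ (fderiv ℝ φ) z h h) 0 := by
    have := HasFDerivAt.comp_hasDerivAt (𝕜 := ℝ) (l := fderiv ℝ φ) (f := fun t : ℝ => z + t • h) 0
      (by simpa using hd) (hl.const_add z)
    simpa using this.clm_apply (hasDerivAt_const (0 : ℝ) h)
  have h2 : HasDerivAt (fun t : ℝ => fderiv ℝ φ (z - t • h) h)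
      (-fderiv ℝ (fderiv ℝ φ) z h h) 0 := by
    have := HasFDerivAt.comp_hasDerivAt (𝕜 := ℝ) (l := fderiv ℝ φ) (f := fun t : ℝ => z - t • h) 0
      (by simpa using hd) (hl.const_sub z)
    simpa using this.clm_apply (hasDerivAt_const (0 : ℝ) h)
  have h3 := (h1.sub h2).tendsto_slope_zero_right
  have hcont : Continuous fun t : ℝ => φ (z + t • h) + φ (z - t • h) - 2 * φ z := by
    have := hφ.continuous
    fun_prop
  refine HasDerivAt.lhopital_zero_nhdsGT (f' := fun t => fderiv ℝ φ (z + t • h) h -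
    fderiv ℝ φ (z - t • h) h) (g' := fun t => 2 * t)
    (Eventually.of_forall fun t => hasDerivAt_symm_sum hφ z h t)
    (Eventually.of_forall fun t => by simpa using hasDerivAt_pow 2 t)
    (eventually_mem_nhdsWithin.mono fun t ht => mul_ne_zero two_ne_zero (ne_of_gt ht))
    ?_ ?_ ?_
  · have := (hcont.tendsto 0).mono_left (nhdsWithin_le_nhds (s := Set.Ioi 0))
    simpa [← two_mul] using this
  · have := ((continuous_pow (M := ℝ) 2).tendsto 0).mono_left (nhdsWithin_le_nhds (s := Set.Ioi 0))
    simpa using this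
  · have h4 := h3.div_const 2
    simp only [sub_neg_eq_add, ← two_mul, mul_div_cancel_left₀ _ (two_ne_zero (α := ℝ))] at h4
    refine h4.congr fun t => ?_
    simp only [Pi.sub_apply, zero_add, zero_smul, add_zero, sub_zero, sub_self, smul_eq_mul]
    rw [div_eq_mul_inv, div_eq_mul_inv, mul_inv]
    ring

end SecondDifference

/-! ### Radial averages of test functions at small scales. -/

namespace IsRadialWeight

variable {ρ : (E N) → ℝ} (hρ : IsRadialWeight ρ) {φ : (E N) → ℝ}

include hρ

/-- Averaging with the reflection `w ↦ -w` removes the first-order term, which is why the averages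
are of order `t ^ 2`. -/
theorem two_mul_integral_difference (hφ : Continuous φ) (t : ℝ) (z : E N) :
    2 * ∫ w, ρ w * (φ (z + t • w) - φ z) =
      ∫ w, ρ w * (φ (z + t • w) + φ (z - t • w) - 2 * φ z) := by
  have h1 : ∫ w, ρ w * (φ (z - t • w) - φ z) = ∫ w, ρ w * (φ (z + t • w) - φ z) := by
    rw [← integral_neg_eq_self]
    simp [hρ.neg]
  rw [two_mul]
  nth_rewrite 2 [← h1]
  rw [← integral_add (hρ.integrable_mul (by fun_prop)) (hρ.integrable_mul (by fun_prop))]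
  refine integral_congr_ae (ae_of_all _ fun w => ?_)
  simp only
  ring

theorem exists_integral_difference_bound (hφ : ContDiff ℝ 2 φ) (hc : HasCompactSupport φ) :
    ∃ C : ℝ, ∀ (t : ℝ) (z : E N), |∫ w, ρ w * (φ (z + t • w) - φ z)| ≤ C * t ^ 2 := by
  obtain ⟨C, hC0, hC⟩ := exists_second_difference_bound hφ hc
  refine ⟨C * ∫ w, ρ w, fun t z => ?_⟩
  have h2 := hρ.two_mul_integral_difference hφ.continuous t z
  have h3 : ‖∫ w, ρ w * (φ (z + t • w) + φ (z - t • w) - 2 * φ z)‖ ≤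
      ∫ w, ρ w * (C * t ^ 2) := by
    refine norm_integral_le_of_norm_le (hρ.integrable.mul_const _) (ae_of_all _ fun w => ?_)
    rw [norm_mul, Real.norm_of_nonneg (hρ.nonneg w)]
    rcases le_or_gt 1 ‖w‖ with hw | hw
    · simp [hρ.eq_zero w hw]
    · refine mul_le_mul_of_nonneg_left ((hC z (t • w)).trans ?_) (hρ.nonneg w)
      rw [norm_smul, mul_pow, Real.norm_eq_abs, sq_abs]
      have : ‖w‖ ^ 2 ≤ 1 := pow_le_one₀ (norm_nonneg _) hw.le
      nlinarith [mul_nonneg hC0 (sq_nonneg t)]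
  rw [← h2, norm_mul, Real.norm_eq_abs, Real.norm_eq_abs, abs_two, integral_mul_const] at h3
  nlinarith [abs_nonneg (∫ w, ρ w * (φ (z + t • w) - φ z))]

theorem tendsto_integral_difference (hφ : ContDiff ℝ 2 φ) (hc : HasCompactSupport φ) (i : Fin N)
    (z : E N) :
    Tendsto (fun t : ℝ => (∫ w, ρ w * (φ (z + t • w) - φ z)) / t ^ 2) (𝓝[>] 0)
      (𝓝 ((∫ w, ρ w * (w i * w i)) / 2 * Laplacian.laplacian φ z)) := by
  obtain ⟨C, hC0, hC⟩ := exists_second_difference_bound hφ hc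
  have hlim : Tendsto (fun t : ℝ =>
      ∫ w, ρ w * ((φ (z + t • w) + φ (z - t • w) - 2 * φ z) / t ^ 2)) (𝓝[>] 0)
      (𝓝 (∫ w, ρ w * fderiv ℝ (fderiv ℝ φ) z w w)) := by
    refine tendsto_integral_filter_of_dominated_convergence (fun w => ρ w * C)
      (Eventually.of_forall fun t => (hρ.integrable_mul ?_).aestronglyMeasurable)
      (eventually_mem_nhdsWithin.mono fun t ht => ae_of_all _ fun w => ?_)
      (hρ.integrable.mul_const _)
      (ae_of_all _ fun w => (tendsto_second_difference hφ z w).const_mul _)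
    · have := hφ.continuous
      fun_prop
    · have ht2 : (0 : ℝ) < t ^ 2 := pow_pos ht 2
      rw [norm_mul, Real.norm_of_nonneg (hρ.nonneg w)]
      rcases le_or_gt 1 ‖w‖ with hw | hw
      · simp [hρ.eq_zero w hw]
      · refine mul_le_mul_of_nonneg_left ?_ (hρ.nonneg w)
        rw [norm_div, Real.norm_of_nonneg ht2.le, div_le_iff₀ ht2]
        refine (hC z (t • w)).trans ?_
        rw [norm_smul, mul_pow, Real.norm_eq_abs, sq_abs]
        have : ‖w‖ ^ 2 ≤ 1 := pow_le_one₀ (norm_nonneg _) hw.le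
        nlinarith [mul_nonneg hC0 (sq_nonneg t)]
  rw [hρ.integral_bilinear i, ← laplacian_eq_sum] at hlim
  have := hlim.div_const 2
  rw [mul_div_right_comm] at this
  refine this.congr fun t => ?_
  simp only [← mul_div_assoc]
  rw [integral_div, ← hρ.two_mul_integral_difference hφ.continuous]
  ring

end IsRadialWeight

/-! ### Self-adjointness and passage to the limit. -/

namespace IsRadialWeight

variable {ρ : (E N) → ℝ} (hρ : IsRadialWeight ρ) {φ : (E N) → ℝ}

include hρ

/-- Averages of translates with respect to a radial weight are self-adjoint. -/
theorem integral_mul_integral_difference {v : (E N) → ℝ} (hv : Measurable v) {M : ℝ}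
    (hM : ∀ z, |v z| ≤ M) (hφ : Continuous φ) (hc : HasCompactSupport φ) (t : ℝ) :
    ∫ z, v z * ∫ w, ρ w * (φ (z + t • w) - φ z) =
      ∫ x, φ x * ∫ w, ρ w * (v (x + t • w) - v x) := by
  have hφi : Integrable φ := hφ.integrable_of_hasCompactSupport hc
  have hρm : AEStronglyMeasurable ρ volume := hρ.integrable.aestronglyMeasurable
  have hM0 : 0 ≤ M := (abs_nonneg _).trans (hM 0)
  have hvφ : ∀ a b : (E N) → (E N), Continuous a → Continuous b →
      Integrable (fun z => φ (b z)) → Integrable fun z => v (a z) * φ (b z) :=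
    fun a b ha hb h => h.bdd_mul (c := M) (hv.comp ha.measurable).aestronglyMeasurable
      (ae_of_all _ fun z => hM _)
  have hφt : ∀ y, Integrable fun z => φ (z + y) := fun y => hφi.comp_add_right y
  have h1 : Integrable (fun p : (E N) × (E N) => φ p.1 * ρ p.2 * (v (p.1 + t • p.2) - v p.1))
      (volume.prod volume) := by
    refine ((hφi.mul_prod hρ.integrable).mul_bdd (c := 2 * M) ?_ (ae_of_all _ fun p => ?_))
    · exact ((hv.comp (by fun_prop)).sub (hv.comp measurable_fst)).aestronglyMeasurable
    · have := abs_sub (v (p.1 + t • p.2)) (v p.1)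
      rw [Real.norm_eq_abs]
      linarith [hM (p.1 + t • p.2), hM p.1]
  -- Here `v` is merely bounded. Integrability comes from the difference of `φ`, which for `‖p.2‖ <
  -- 1` vanishes when `p.1` is outside the ball of radius `R + |t|`.
  have h2 : Integrable (fun p : (E N) × (E N) => v p.1 * (ρ p.2 * (φ (p.1 + t • p.2) - φ p.1)))
      (volume.prod volume) := by
    obtain ⟨R, hR⟩ := hc.isCompact.isBounded.exists_norm_le
    obtain ⟨C, hC⟩ := hφ.bounded_above_of_compact_support hc
    have hC0 : 0 ≤ C := (norm_nonneg _).trans (hC 0)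
    have hball : Integrable ((Metric.closedBall (0 : E N) (R + |t|)).indicator
        fun _ => M * (2 * C)) :=
      (integrable_indicator_iff Metric.isClosed_closedBall.measurableSet).mpr
        (integrableOn_const measure_closedBall_lt_top.ne)
    refine (hball.mul_prod hρ.integrable).mono' ?_ (ae_of_all _ fun p => ?_)
    · refine (hv.comp measurable_fst).aestronglyMeasurable.mul (hρm.comp_snd.mul ?_)
      exact ((hφ.comp (by fun_prop)).sub (hφ.comp continuous_fst)).aestronglyMeasurable
    · rcases le_or_gt 1 ‖p.2‖ with hw | hw
      · simp [hρ.eq_zero _ hw]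
      by_cases hz : p.1 ∈ Metric.closedBall (0 : E N) (R + |t|)
      · rw [Set.indicator_of_mem hz, norm_mul, norm_mul, Real.norm_of_nonneg (hρ.nonneg p.2),
          mul_comm (ρ p.2), ← mul_assoc]
        refine mul_le_mul_of_nonneg_right (mul_le_mul (hM _) ?_ (norm_nonneg _) hM0)
          (hρ.nonneg _)
        exact (norm_sub_le _ _).trans (by linarith [hC (p.1 + t • p.2), hC p.1])
      · rw [mem_closedBall_zero_iff, not_le] at hz
        have hz1 : φ p.1 = 0 := image_eq_zero_of_notMem_tsupport fun h => by
          linarith [hR _ h, abs_nonneg t]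
        have hz2 : φ (p.1 + t • p.2) = 0 := image_eq_zero_of_notMem_tsupport fun h => by
          have h3 := norm_sub_le (p.1 + t • p.2) (t • p.2)
          rw [add_sub_cancel_right, norm_smul, Real.norm_eq_abs] at h3
          nlinarith [hR _ h, abs_nonneg t]
        simp [hz1, hz2, Set.indicator_of_notMem, hz]
  have hswap : ∀ w : E N, ∫ z, v z * (φ (z + t • -w) - φ z) = ∫ x, φ x * (v (x + t • w) - v x) := by
    intro w
    have hb : Integrable fun z => v z * φ z := hvφ id id continuous_id continuous_id hφi
    have ha : Integrable fun z => v z * φ (z + t • -w) :=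
      hvφ id (fun z => z + t • -w) continuous_id (by fun_prop) (hφt _)
    have hd : Integrable fun z => v (z + t • w) * φ z :=
      hvφ (fun z => z + t • w) id (by fun_prop) continuous_id hφi
    simp only [mul_comm (φ _)]
    simp only [mul_sub, sub_mul]
    rw [integral_sub ha hb, integral_sub hd hb,
      ← integral_add_right_eq_self (fun z => v z * φ (z + t • -w)) (t • w)]
    simp
  calc ∫ z, v z * ∫ w, ρ w * (φ (z + t • w) - φ z)
      = ∫ z, ∫ w, v z * (ρ w * (φ (z + t • w) - φ z)) := by simp only [integral_const_mul]
    _ = ∫ w, ∫ z, v z * (ρ w * (φ (z + t • w) - φ z)) := integral_integral_swap h2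
    _ = ∫ w, ρ w * ∫ z, v z * (φ (z + t • w) - φ z) := by
        simp only [mul_left_comm (v _), integral_const_mul]
    _ = ∫ w, ρ w * ∫ x, φ x * (v (x + t • w) - v x) := by
        rw [← integral_neg_eq_self]
        simp only [hρ.neg, hswap]
    _ = ∫ w, ∫ x, φ x * ρ w * (v (x + t • w) - v x) := by
        simp only [← integral_const_mul, mul_assoc, mul_left_comm (ρ _)]
    _ = ∫ x, ∫ w, φ x * ρ w * (v (x + t • w) - v x) := (integral_integral_swap h1).symm
    _ = ∫ x, φ x * ∫ w, ρ w * (v (x + t • w) - v x) := by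
        simp only [mul_assoc, integral_const_mul]

/-- A bounded pointwise limit of functions with the mean value property at scales tending to zero
is harmonic in the sense of distributions. -/
theorem integral_mul_laplacian_eq_zero (i : Fin N) {v : ℕ → (E N) → ℝ} {u : (E N) → ℝ}
    (hv : ∀ k, Measurable (v k)) {M : ℝ} (hM : ∀ k z, |v k z| ≤ M)
    (hlim : ∀ z, Tendsto (fun k => v k z) atTop (𝓝 (u z)))
    {ε : ℕ → ℝ} (hε : ∀ k, ε k ∈ Set.Ioo (0 : ℝ) 1) (hε0 : Tendsto ε atTop (𝓝 0))
    (hφ : ContDiff ℝ 2 φ) (hc : HasCompactSupport φ)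
    (hmean : ∀ᶠ k in atTop, ∀ x ∈ tsupport φ, ∫ w, ρ w * (v k (x + ε k • w) - v k x) = 0) :
    ∫ z, u z * Laplacian.laplacian φ z = 0 := by
  obtain ⟨C, hC⟩ := hρ.exists_integral_difference_bound hφ hc
  obtain ⟨R, hR⟩ := hc.isCompact.isBounded.exists_norm_le
  have hM0 : 0 ≤ M := (abs_nonneg _).trans (hM 0 0)
  have hε0' : Tendsto ε atTop (𝓝[>] 0) :=
    tendsto_nhdsWithin_iff.mpr ⟨hε0, Eventually.of_forall fun k => (hε k).1⟩
  -- Self-adjointness moves the averaging onto `v k`, where it vanishes on the support of `φ`.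
  have hzero : ∀ᶠ k in atTop,
      ∫ z, v k z * ((∫ w, ρ w * (φ (z + ε k • w) - φ z)) / ε k ^ 2) = 0 := by
    filter_upwards [hmean] with k hk
    simp only [← mul_div_assoc]
    rw [integral_div, hρ.integral_mul_integral_difference (hv k) (hM k) hφ.continuous hc]
    have : ∀ x, φ x * ∫ w, ρ w * (v k (x + ε k • w) - v k x) = 0 := fun x => by
      by_cases hx : x ∈ tsupport φ
      · rw [hk x hx, mul_zero]
      · rw [image_eq_zero_of_notMem_tsupport hx, zero_mul]
    simp [this]
  have hconv : Tendsto (fun k => ∫ z, v k z * ((∫ w, ρ w * (φ (z + ε k • w) - φ z)) / ε k ^ 2))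
      atTop (𝓝 (∫ z, u z * ((∫ w, ρ w * (w i * w i)) / 2 * Laplacian.laplacian φ z))) := by
    refine tendsto_integral_of_dominated_convergence
      -- Radius `R + 1` suffices for all `k` because `ε k < 1`.
      ((Metric.closedBall (0 : E N) (R + 1)).indicator fun _ => M * C) (fun k => ?_)
      ((integrable_indicator_iff Metric.isClosed_closedBall.measurableSet).mpr
        (integrableOn_const measure_closedBall_lt_top.ne)) (fun k => ae_of_all _ fun z => ?_)
      (ae_of_all _ fun z => (hlim z).mul
        ((hρ.tendsto_integral_difference hφ hc i z).comp hε0'))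
    · have hm : AEStronglyMeasurable (fun p : (E N) × (E N) =>
          ρ p.2 * (φ (p.1 + ε k • p.2) - φ p.1)) (volume.prod volume) :=
        hρ.integrable.aestronglyMeasurable.comp_snd.mul
          ((hφ.continuous.comp (by fun_prop)).sub
            (hφ.continuous.comp continuous_fst)).aestronglyMeasurable
      exact (hv k).aestronglyMeasurable.mul
        (hm.integral_prod_right'.aemeasurable.div_const _).aestronglyMeasurable
    · by_cases hz : z ∈ Metric.closedBall (0 : E N) (R + 1)
      · rw [Set.indicator_of_mem hz, norm_mul]
        refine mul_le_mul (hM k z) ?_ (norm_nonneg _) hM0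
        have h2 : (0 : ℝ) < ε k ^ 2 := pow_pos (hε k).1 2
        rw [norm_div, Real.norm_of_nonneg h2.le, div_le_iff₀ h2]
        exact hC _ z
      · rw [Set.indicator_of_notMem hz]
        rw [mem_closedBall_zero_iff, not_le] at hz
        have hz1 : φ z = 0 := image_eq_zero_of_notMem_tsupport fun h => by linarith [hR _ h]
        have hint : ∀ w, ρ w * (φ (z + ε k • w) - φ z) = 0 := fun w => by
          rcases le_or_gt 1 ‖w‖ with hw | hw
          · simp [hρ.eq_zero _ hw]
          have hz2 : φ (z + ε k • w) = 0 := image_eq_zero_of_notMem_tsupport fun h => by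
            have h3 := norm_sub_le (z + ε k • w) (ε k • w)
            rw [add_sub_cancel_right, norm_smul, Real.norm_of_nonneg (hε k).1.le] at h3
            nlinarith [hR _ h, (hε k).1, (hε k).2]
          rw [hz1, hz2, sub_zero, mul_zero]
        simp [hint]
  have h0 := tendsto_nhds_unique (tendsto_const_nhds.congr' (hzero.mono fun k hk => hk.symm)) hconv
  simp only [mul_left_comm (u _), integral_const_mul] at h0
  exact (mul_eq_zero.mp h0.symm).resolve_left (half_pos (hρ.integral_coord_sq_pos i)).ne'

end IsRadialWeight

/-- The indicator function of the open unit ball is a radial weight. -/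
theorem isRadialWeight_indicator :
    IsRadialWeight ((Metric.ball (0 : E N) 1).indicator fun _ => (1 : ℝ)) where
  integrable := (integrable_indicator_iff Metric.isOpen_ball.measurableSet).mpr
    (integrableOn_const measure_ball_lt_top.ne)
  nonneg := Set.indicator_nonneg fun _ _ => zero_le_one
  eq_zero w hw := Set.indicator_of_notMem (by simpa using hw) _
  pos w hw := by rw [Set.indicator_of_mem (by simpa using hw)]; exact one_pos
  map_eq L w := by simp [Set.indicator]

/-! ### Smooth radial test functions and kernels. -/

/-- A smooth function on the line, positive for `t < 1` and zero for `1 ≤ t`. -/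
noncomputable def profile (t : ℝ) : ℝ := expNegInvGlue (1 - t)

theorem contDiff_profile {n : ℕ∞} : ContDiff ℝ n profile :=
  expNegInvGlue.contDiff.comp (contDiff_const.sub contDiff_id)

theorem profile_nonneg (t : ℝ) : 0 ≤ profile t := expNegInvGlue.nonneg _

theorem profile_pos {t : ℝ} (ht : t < 1) : 0 < profile t :=
  expNegInvGlue.pos_of_pos (sub_pos.mpr ht)

theorem profile_eq_zero {t : ℝ} (ht : 1 ≤ t) : profile t = 0 :=
  expNegInvGlue.zero_of_nonpos (sub_nonpos.mpr ht)

theorem continuous_profile : Continuous profile := (contDiff_profile (n := 0)).continuous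

theorem contDiff_deriv_profile {n : ℕ∞} : ContDiff ℝ n (deriv profile) :=
  ((contDiff_infty_iff_deriv (f := profile)).mp contDiff_profile).2.of_le (by exact_mod_cast le_top)

theorem hasDerivAt_profile (t : ℝ) : HasDerivAt profile (deriv profile t) t :=
  (((contDiff_profile (n := 1)).differentiable (by norm_num)) t).hasDerivAt

theorem deriv_profile_eq_zero {t : ℝ} (ht : 1 ≤ t) : deriv profile t = 0 :=
  IsLocalMin.deriv_eq_zero (Eventually.of_forall fun s => by
    rw [profile_eq_zero ht]; exact profile_nonneg s)

/-- An antiderivative of `-profile` vanishing for `1 ≤ t`. -/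
noncomputable def profileTail (t : ℝ) : ℝ := -∫ s in (1 : ℝ)..t, profile s

theorem hasDerivAt_profileTail (t : ℝ) : HasDerivAt profileTail (-profile t) t :=
  (intervalIntegral.integral_hasDerivAt_right (continuous_profile.intervalIntegrable _ _)
    (continuous_profile.stronglyMeasurableAtFilter _ _) continuous_profile.continuousAt).neg

theorem contDiff_profileTail : ContDiff ℝ 2 profileTail := by
  have hd : deriv profileTail = fun t => -profile t :=
    funext fun t => (hasDerivAt_profileTail t).deriv
  have h := (contDiff_succ_iff_deriv (n := 1) (f := profileTail)).mpr
    ⟨fun t => (hasDerivAt_profileTail t).differentiableAt, by simp,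
      hd ▸ (contDiff_profile (n := 1)).neg⟩
  simpa [one_add_one_eq_two] using h

theorem profileTail_eq_zero {t : ℝ} (ht : 1 ≤ t) : profileTail t = 0 := by
  rw [profileTail, neg_eq_zero]
  refine intervalIntegral.integral_zero_ae (ae_of_all _ fun s hs => ?_)
  rw [Set.uIoc_of_le ht] at hs
  exact profile_eq_zero hs.1.le

/-- The radial test function with centre `x` and radius `s`. -/
noncomputable def radialTest (x : E N) (s : ℝ) (z : E N) : ℝ := profileTail (‖z - x‖ ^ 2 / s ^ 2)

theorem one_le_sq_div {x z : E N} {s : ℝ} (hs : 0 < s) (hz : s ≤ ‖z - x‖) :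
    1 ≤ ‖z - x‖ ^ 2 / s ^ 2 := by
  rw [one_le_div (pow_pos hs 2)]
  gcongr

theorem contDiff_radialTest (x : E N) (s : ℝ) : ContDiff ℝ 2 (radialTest x s) :=
  contDiff_profileTail.comp (((contDiff_id.sub contDiff_const).norm_sq ℝ).div_const _)

theorem tsupport_radialTest_subset (x : E N) {s : ℝ} (hs : 0 < s) :
    tsupport (radialTest x s) ⊆ Metric.closedBall x s := by
  refine closure_minimal (fun z hz => ?_) Metric.isClosed_closedBall
  by_contra hzx
  rw [Metric.mem_closedBall, dist_eq_norm, not_le] at hzx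
  exact hz (profileTail_eq_zero (one_le_sq_div hs hzx.le))

theorem hasCompactSupport_radialTest (x : E N) {s : ℝ} (hs : 0 < s) :
    HasCompactSupport (radialTest x s) :=
  (isCompact_closedBall x s).of_isClosed_subset (isClosed_tsupport _)
    (tsupport_radialTest_subset x hs)

theorem hasFDerivAt_sq_div (x z : E N) (s : ℝ) :
    HasFDerivAt (fun z : E N => ‖z - x‖ ^ 2 / s ^ 2) ((2 / s ^ 2) • innerSL ℝ (z - x)) z := by
  have h := (((hasFDerivAt_id (𝕜 := ℝ) z).sub_const x).norm_sq).mul_const (s ^ 2)⁻¹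
  simp only [id, ← div_eq_mul_inv] at h
  refine h.congr_fderiv ?_
  ext w
  simp
  ring

theorem fderiv_radialTest (x : E N) (s : ℝ) : fderiv ℝ (radialTest x s) =
    fun z => (-profile (‖z - x‖ ^ 2 / s ^ 2) * (2 / s ^ 2)) • innerSL ℝ (z - x) := by
  funext z
  rw [mul_smul]
  exact ((hasDerivAt_profileTail _).comp_hasFDerivAt z (hasFDerivAt_sq_div x z s)).fderiv

theorem fderiv_fderiv_radialTest (x z v : E N) (s : ℝ) :
    fderiv ℝ (fderiv ℝ (radialTest x s)) z v v =
      -(2 / s ^ 2) * profile (‖z - x‖ ^ 2 / s ^ 2) * ‖v‖ ^ 2 +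
      -(2 / s ^ 2) * (2 / s ^ 2) * deriv profile (‖z - x‖ ^ 2 / s ^ 2) *
        ‖(inner ℝ (z - x) v : ℝ)‖ ^ 2 := by
  have hd : DifferentiableAt ℝ (fderiv ℝ (radialTest x s)) z :=
    (((contDiff_radialTest x s).fderiv_right (m := 1) (by norm_num)).differentiable
      (by norm_num)) z
  have h0 : HasFDerivAt (fun y => fderiv ℝ (radialTest x s) y v)
      ((ContinuousLinearMap.apply ℝ ℝ v).comp (fderiv ℝ (fderiv ℝ (radialTest x s)) z)) z :=
    (ContinuousLinearMap.apply ℝ ℝ v).hasFDerivAt.comp z hd.hasFDerivAt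
  have heq : (fun y => fderiv ℝ (radialTest x s) y v) =
      fun y => -profile (‖y - x‖ ^ 2 / s ^ 2) * (2 / s ^ 2) * innerSL ℝ v (y - x) := by
    rw [fderiv_radialTest]
    funext y
    simp only [smul_apply, innerSL_apply_apply, smul_eq_mul, real_inner_comm v]
  have h1 : HasFDerivAt (fun y : E N => -profile (‖y - x‖ ^ 2 / s ^ 2) * (2 / s ^ 2)) _ z :=
    ((hasDerivAt_profile _).comp_hasFDerivAt z (hasFDerivAt_sq_div x z s)).neg.mul_const (2 / s ^ 2)
  have h2 : HasFDerivAt (fun y : E N => innerSL ℝ v (y - x)) (innerSL ℝ v) z :=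
    (innerSL ℝ v).hasFDerivAt.comp z ((hasFDerivAt_id (𝕜 := ℝ) z).sub_const x)
  rw [heq] at h0
  have h3 := DFunLike.congr_fun (h0.unique (h1.mul h2)) v
  simp only [ContinuousLinearMap.comp_apply, ContinuousLinearMap.apply_apply, add_apply,
    smul_apply, neg_apply, innerSL_apply_apply, smul_eq_mul, real_inner_self_eq_norm_sq] at h3
  rw [h3, real_inner_comm (z - x) v, Real.norm_eq_abs, sq_abs]
  ring

theorem laplacian_radialTest (x z : E N) (s : ℝ) : Laplacian.laplacian (radialTest x s) z =
    -(2 / s ^ 2) * (N * profile (‖z - x‖ ^ 2 / s ^ 2) +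
      2 * (‖z - x‖ ^ 2 / s ^ 2) * deriv profile (‖z - x‖ ^ 2 / s ^ 2)) := by
  rw [laplacian_eq_sum]
  simp only [fderiv_fderiv_radialTest, OrthonormalBasis.norm_eq_one]
  rw [Finset.sum_add_distrib, ← Finset.mul_sum, ← Finset.mul_sum,
    OrthonormalBasis.sum_sq_norm_inner_left,
    Finset.sum_const, Finset.card_univ, Fintype.card_fin, nsmul_eq_mul]
  ring

/-- The normalised radial kernel of radius `s`. -/
noncomputable def kernel (N : ℕ) (s : ℝ) (y : E N) : ℝ :=
  s ^ (-(N : ℤ)) * profile (‖y‖ ^ 2 / s ^ 2)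

/-- With `τ = ‖z - x‖² / s²`, both sides equal `-s⁻ᴺ⁻¹ (N profile τ + 2 τ profile' τ)`. The test
function is built from an antiderivative of `-profile` precisely to make this identity hold. -/
theorem hasDerivAt_kernel (x z : E N) {s : ℝ} (hs : 0 < s) :
    HasDerivAt (fun s => kernel N s (z - x))
      (s ^ (-(N : ℤ)) * s / 2 * Laplacian.laplacian (radialTest x s) z) s := by
  have h1 : HasDerivAt (fun s : ℝ => s ^ (-(N : ℤ))) ((-(N : ℤ) : ℤ) * s ^ (-(N : ℤ) - 1)) s :=
    hasDerivAt_zpow _ _ (Or.inl hs.ne')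
  have h2 : HasDerivAt (fun s : ℝ => ‖z - x‖ ^ 2 / s ^ 2) (-(2 * ‖z - x‖ ^ 2 / s ^ 3)) s := by
    refine ((hasDerivAt_const s (‖z - x‖ ^ 2)).div (hasDerivAt_pow 2 s)
      (pow_ne_zero 2 hs.ne')).congr_deriv ?_
    field_simp
    norm_num
    ring
  refine (h1.mul ((hasDerivAt_profile _).comp s h2)).congr_deriv ?_
  rw [laplacian_radialTest, zpow_sub_one₀ hs.ne']
  push_cast
  simp only [Function.comp]
  generalize s ^ (-(N : ℤ)) = p
  generalize deriv profile _ = b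
  generalize profile _ = a
  field_simp
  ring

theorem continuous_kernel (s : ℝ) : Continuous (kernel N s) := by
  unfold kernel
  have := continuous_profile
  fun_prop

theorem contDiff_kernel (s : ℝ) : ContDiff ℝ 2 (kernel N s) :=
  contDiff_const.mul ((contDiff_profile (n := 2)).comp ((contDiff_id.norm_sq ℝ).div_const _))

theorem hasCompactSupport_kernel {s : ℝ} (hs : 0 < s) : HasCompactSupport (kernel N s) :=
  HasCompactSupport.intro (isCompact_closedBall 0 s) fun z hz => by
    rw [mem_closedBall_zero_iff, not_le] at hz
    have := one_le_sq_div (x := 0) (z := z) hs (by simpa using hz.le)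
    rw [sub_zero] at this
    rw [kernel, profile_eq_zero this, mul_zero]

/-- The kernel of radius one, as a radial weight. -/
theorem isRadialWeight_profile : IsRadialWeight fun w : E N => profile (‖w‖ ^ 2) where
  integrable := by
    have h := (continuous_kernel (N := N) 1).integrable_of_hasCompactSupport
      (μ := volume) (hasCompactSupport_kernel one_pos)
    refine h.congr (ae_of_all _ fun w => ?_)
    simp [kernel]
  nonneg _ := profile_nonneg _
  eq_zero w hw := profile_eq_zero (one_le_pow₀ hw)
  pos w hw := profile_pos (pow_lt_one₀ (norm_nonneg w) hw two_ne_zero)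
  map_eq L w := by rw [L.norm_map]

/-- Substituting `z = x + s w`, the Jacobian cancels the factor `s⁻ᴺ`. -/
theorem integral_mul_kernel (f : (E N) → ℝ) (x : E N) {s : ℝ} (hs : 0 < s) :
    ∫ z, f z * kernel N s (z - x) = ∫ w, profile (‖w‖ ^ 2) * f (x + s • w) := by
  rw [← integral_add_right_eq_self _ x]
  have h := Measure.integral_comp_smul (volume : Measure (E N))
    (fun z => f (z + x) * kernel N s (z + x - x)) s
  rw [finrank_euclideanSpace_fin, abs_of_pos (inv_pos.mpr (pow_pos hs N)), smul_eq_mul] at h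
  have h2 : ∀ w : E N, f (s • w + x) * kernel N s (s • w + x - x) =
      (s ^ N)⁻¹ * (profile (‖w‖ ^ 2) * f (x + s • w)) := fun w => by
    rw [add_sub_cancel_right, kernel, norm_smul, mul_pow, Real.norm_eq_abs, sq_abs,
      mul_div_cancel_left₀ _ (pow_ne_zero 2 hs.ne'), zpow_neg, zpow_natCast, add_comm]
    ring
  simp only [h2, integral_const_mul] at h
  exact (mul_left_cancel₀ (inv_ne_zero (pow_ne_zero N hs.ne')) h).symm

theorem exists_laplacian_radialTest_bound (N : ℕ) :
    ∃ C : ℝ, 0 ≤ C ∧ ∀ (x z : E N) {s : ℝ}, 0 < s →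
      |Laplacian.laplacian (radialTest x s) z| ≤ 2 / s ^ 2 * C := by
  have hc : Continuous fun t : ℝ => N * profile t + 2 * t * deriv profile t := by
    have h1 := continuous_profile
    have h2 := (contDiff_deriv_profile (n := 0)).continuous
    fun_prop
  obtain ⟨C, hC⟩ := (isCompact_Icc (a := (0 : ℝ)) (b := 1)).exists_bound_of_continuousOn
    hc.continuousOn
  have hC0 : 0 ≤ C := (norm_nonneg _).trans (hC 0 (by simp))
  refine ⟨C, hC0, fun x z s hs => ?_⟩
  rw [laplacian_radialTest, abs_mul, abs_neg, abs_of_pos (by positivity : 0 < 2 / s ^ 2)]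
  refine mul_le_mul_of_nonneg_left ?_ (by positivity)
  rcases le_total 1 (‖z - x‖ ^ 2 / s ^ 2) with h | h
  · rw [profile_eq_zero h, deriv_profile_eq_zero h]
    simpa using hC0
  · exact hC _ ⟨by positivity, h⟩

theorem continuous_laplacian_radialTest (x : E N) (s : ℝ) :
    Continuous (Laplacian.laplacian (radialTest x s)) := by
  have h1 := continuous_profile
  have h2 := (contDiff_deriv_profile (n := 0)).continuous
  have h3 : Laplacian.laplacian (radialTest x s) = _ := funext fun z => laplacian_radialTest x z s
  rw [h3]
  fun_prop

/-! ### Weyl's lemma. -/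

theorem hasDerivAt_integral_kernel {f : (E N) → ℝ} (hf : Integrable f) (x : E N) {s : ℝ}
    (hs : 0 < s) :
    HasDerivAt (fun s => ∫ z, f z * kernel N s (z - x))
      (∫ z, f z * (s ^ (-(N : ℤ)) * s / 2 * Laplacian.laplacian (radialTest x s) z)) s := by
  obtain ⟨C, hC0, hC⟩ := exists_laplacian_radialTest_bound N
  -- A neighbourhood of `s` away from `0`, on which the derivative bound is uniform.
  have hpos : ∀ r ∈ Set.Icc (s / 2) (3 * s / 2), 0 < r := fun r hr => by linarith [hr.1]
  have hcont : ContinuousOn (fun r : ℝ => r ^ (-(N : ℤ)) * r / 2 * (2 / r ^ 2 * C))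
      (Set.Icc (s / 2) (3 * s / 2)) := fun r hr => by
    have h0 := (hpos r hr).ne'
    have h1 : ContinuousAt (fun r : ℝ => r ^ (-(N : ℤ))) r := continuousAt_zpow₀ r _ (Or.inl h0)
    have h2 : ContinuousAt (fun r : ℝ => 2 / r ^ 2) r :=
      continuousAt_const.div (continuousAt_id.pow 2) (pow_ne_zero 2 h0)
    exact (((h1.mul continuousAt_id).div_const 2).mul
      (h2.mul continuousAt_const)).continuousWithinAt
  obtain ⟨B, hB⟩ := isCompact_Icc.exists_bound_of_continuousOn hcont
  have hker : ∀ r, Continuous fun z : E N => kernel N r (z - x) := fun r =>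
    (continuous_kernel r).comp (continuous_id.sub continuous_const)
  refine (hasDerivAt_integral_of_dominated_loc_of_deriv_le (bound := fun z => ‖f z‖ * B)
    (F' := fun r z => f z * (r ^ (-(N : ℤ)) * r / 2 * Laplacian.laplacian (radialTest x r) z))
    (Icc_mem_nhds (by linarith) (by linarith) : Set.Icc (s / 2) (3 * s / 2) ∈ 𝓝 s)
    (Eventually.of_forall fun r => hf.aestronglyMeasurable.mul (hker r).aestronglyMeasurable)
    ?_ ?_ (ae_of_all _ fun z r hr => ?_) (hf.norm.mul_const B) (ae_of_all _ fun z r hr => ?_)).2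
  · obtain ⟨K, hK⟩ := (continuous_kernel (N := N) s).bounded_above_of_compact_support
      (hasCompactSupport_kernel hs)
    exact hf.mul_bdd (hker s).aestronglyMeasurable (ae_of_all _ fun z => hK (z - x))
  · exact hf.aestronglyMeasurable.mul
      ((continuous_laplacian_radialTest x s).const_mul _).aestronglyMeasurable
  · have hr0 := hpos r hr
    rw [norm_mul]
    refine mul_le_mul_of_nonneg_left (le_trans ?_ ((le_abs_self _).trans (hB r hr))) (norm_nonneg _)
    rw [norm_mul, Real.norm_of_nonneg (by positivity)]
    exact mul_le_mul_of_nonneg_left (hC x z hr0) (by positivity)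
  · exact (hasDerivAt_kernel x z (hpos r hr)).const_mul (f z)

/-- The weighted mean value property. -/
theorem integral_profile_mul_eq {f : (E N) → ℝ} (hf : Integrable f) {M : ℝ}
    (hM : ∀ z, |f z| ≤ M) (hfm : Measurable f) {x : E N} (hfx : ContinuousAt f x) {r : ℝ}
    (hlap : ∀ s, 0 < s → s < r → ∫ z, f z * Laplacian.laplacian (radialTest x s) z = 0)
    {s : ℝ} (hs : 0 < s) (hsr : s < r) :
    ∫ w, profile (‖w‖ ^ 2) * f (x + s • w) = (∫ w : E N, profile (‖w‖ ^ 2)) * f x := by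
  have hder : ∀ t, 0 < t → t < r → HasDerivAt (fun s => ∫ z, f z * kernel N s (z - x)) 0 t :=
    fun t ht htr => by
      have h := hasDerivAt_integral_kernel hf x ht
      simp only [mul_left_comm (f _), integral_const_mul] at h
      rwa [hlap t ht htr, mul_zero] at h
  have hconst : ∀ t, 0 < t → t ≤ s → ∫ w, profile (‖w‖ ^ 2) * f (x + t • w) =
      ∫ w, profile (‖w‖ ^ 2) * f (x + s • w) := fun t ht hts => by
    rw [← integral_mul_kernel f x ht, ← integral_mul_kernel f x hs]
    exact (constant_of_has_deriv_right_zero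
      (f := fun s => ∫ z, f z * kernel N s (z - x))
      (fun y hy => (hder y (ht.trans_le hy.1) (hy.2.trans_lt hsr)).continuousAt.continuousWithinAt)
      (fun y hy => (hder y (ht.trans_le hy.1) (hy.2.trans hsr)).hasDerivWithinAt) s
      ⟨hts, le_rfl⟩).symm
  have hρ := isRadialWeight_profile (N := N)
  have hlim : Tendsto (fun t : ℝ => ∫ w, profile (‖w‖ ^ 2) * f (x + t • w)) (𝓝[>] 0)
      (𝓝 (∫ w : E N, profile (‖w‖ ^ 2) * f x)) := by
    refine tendsto_integral_filter_of_dominated_convergence (fun w => profile (‖w‖ ^ 2) * M)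
      (Eventually.of_forall fun t => hρ.integrable.aestronglyMeasurable.mul
        (hfm.comp (by fun_prop)).aestronglyMeasurable)
      (Eventually.of_forall fun t => ae_of_all _ fun w => ?_) (hρ.integrable.mul_const M)
      (ae_of_all _ fun w => Tendsto.const_mul _ ?_)
    · rw [norm_mul, Real.norm_of_nonneg (profile_nonneg _)]
      exact mul_le_mul_of_nonneg_left (hM _) (profile_nonneg _)
    · have hl : Tendsto (fun t : ℝ => x + t • w) (𝓝[>] 0) (𝓝 x) := by
        have : Continuous fun t : ℝ => x + t • w := by fun_prop
        simpa using (this.tendsto 0).mono_left nhdsWithin_le_nhds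
      exact hfx.tendsto.comp hl
  rw [integral_mul_const] at hlim
  refine tendsto_nhds_unique (tendsto_const_nhds.congr' ?_) hlim
  filter_upwards [Ioc_mem_nhdsGT hs] with t ht
  exact (hconst t ht.1 ht.2).symm

/-- The convolution of a function with the kernel of radius `s`. -/
noncomputable def mollify (f : (E N) → ℝ) (s : ℝ) : (E N) → ℝ :=
  convolution f (kernel N s) (ContinuousLinearMap.mul ℝ ℝ) volume

theorem contDiff_mollify {f : (E N) → ℝ} (hf : Integrable f) {s : ℝ} (hs : 0 < s) :
    ContDiff ℝ 2 (mollify f s) := by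
  have hk : ContDiff ℝ ((2 : ℕ∞) : WithTop ℕ∞) (kernel N s) := by
    exact_mod_cast contDiff_kernel s
  have h := (hasCompactSupport_kernel hs).contDiff_convolution_right
    (ContinuousLinearMap.mul ℝ ℝ) hf.locallyIntegrable hk
  exact_mod_cast h

theorem hasCompactSupport_mollify {f : (E N) → ℝ} (hf : HasCompactSupport f) {s : ℝ} (hs : 0 < s) :
    HasCompactSupport (mollify f s) :=
  hf.convolution (ContinuousLinearMap.mul ℝ ℝ) (hasCompactSupport_kernel hs)

theorem mollify_apply (f : (E N) → ℝ) (s : ℝ) (x : E N) :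
    mollify f s x = ∫ z, f z * kernel N s (z - x) := by
  simp only [mollify, convolution_def, ContinuousLinearMap.mul_apply', kernel, norm_sub_rev]

/-- **Weyl's lemma** for continuous functions. -/
theorem harmonicOnNhd_of_integral_mul_laplacian (hN : 1 ≤ N) {D : Set (E N)} (hD : IsOpen D)
    {u : (E N) → ℝ} (hu : ContinuousOn u D)
    (h : ∀ φ : (E N) → ℝ, ContDiff ℝ 2 φ → HasCompactSupport φ → tsupport φ ⊆ D →
      ∫ z, D.indicator u z * Laplacian.laplacian φ z = 0) :
    InnerProductSpace.HarmonicOnNhd u D := by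
  intro x₀ hx₀
  obtain ⟨R, hR, hRD⟩ := Metric.nhds_basis_closedBall.mem_iff.mp (hD.mem_nhds hx₀)
  -- Balls of radius at most `r` centred in `ball x₀ r` stay inside `closedBall x₀ R`.
  set r := R / 2 with hr
  have hr0 : 0 < r := half_pos hR
  set f := (Metric.closedBall x₀ R).indicator u with hf
  have huR : ContinuousOn u (Metric.closedBall x₀ R) := hu.mono hRD
  have hfi : Integrable f := (integrable_indicator_iff Metric.isClosed_closedBall.measurableSet).mpr
    (huR.integrableOn_compact (isCompact_closedBall x₀ R))
  obtain ⟨M, hM⟩ := (isCompact_closedBall x₀ R).exists_bound_of_continuousOn huR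
  have hM0 : 0 ≤ M := (norm_nonneg _).trans (hM x₀ (Metric.mem_closedBall_self hR.le))
  have hfM : ∀ z, |f z| ≤ M := fun z => by
    by_cases hz : z ∈ Metric.closedBall x₀ R
    · rw [hf, Set.indicator_of_mem hz]; exact hM z hz
    · rw [hf, Set.indicator_of_notMem hz, abs_zero]; exact hM0
  have hfm : Measurable f := by
    classical
    rw [hf, ← Set.piecewise_eq_indicator]
    exact huR.measurable_piecewise continuousOn_const Metric.isClosed_closedBall.measurableSet
  have hfu : ∀ z ∈ Metric.ball x₀ R, f =ᶠ[𝓝 z] u := fun z hz => by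
    filter_upwards [Metric.isOpen_ball.mem_nhds hz] with y hy
    exact Set.indicator_of_mem (Metric.ball_subset_closedBall hy) _
  have hsub : ∀ x ∈ Metric.ball x₀ r, ∀ s ≤ r, Metric.closedBall x s ⊆ Metric.closedBall x₀ R :=
    fun x hx s hs => Metric.closedBall_subset_closedBall' (by
      rw [Metric.mem_ball] at hx; linarith)
  have hballR : Metric.ball x₀ r ⊆ Metric.ball x₀ R := Metric.ball_subset_ball (by linarith)
  have hlap : ∀ x ∈ Metric.ball x₀ r, ∀ s, 0 < s → s < r →
      ∫ z, f z * Laplacian.laplacian (radialTest x s) z = 0 := fun x hx s hs hsr => by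
    refine (integral_congr_ae (ae_of_all _ fun z => ?_)).trans (h (radialTest x s)
      (contDiff_radialTest x s) (hasCompactSupport_radialTest x hs)
      ((tsupport_radialTest_subset x hs).trans ((hsub x hx s hsr.le).trans hRD)))
    by_cases hz : z ∈ Metric.closedBall x₀ R
    · simp only [hf, Set.indicator_of_mem hz, Set.indicator_of_mem (hRD hz)]
    -- Where `f` and `D.indicator u` may differ, the Laplacian of the test function is zero.
    · have hzs : s ≤ ‖z - x‖ := by
        by_contra hlt
        exact hz (hsub x hx s hsr.le (by
          rw [Metric.mem_closedBall, dist_eq_norm]; exact (not_le.mp hlt).le))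
      have h1 := one_le_sq_div hs hzs
      simp only [laplacian_radialTest, profile_eq_zero h1, deriv_profile_eq_zero h1, mul_zero,
        add_zero]
  have hρ := isRadialWeight_profile (N := N)
  set c := ∫ w : E N, profile (‖w‖ ^ 2) with hc
  have hmean : ∀ x ∈ Metric.ball x₀ r, ∀ s, 0 < s → s < r →
      ∫ w, profile (‖w‖ ^ 2) * f (x + s • w) = c * u x := fun x hx s hs hsr => by
    have hfx := hfu x (hballR hx)
    rw [integral_profile_mul_eq hfi hfM hfm
      ((hu.continuousAt (hD.mem_nhds (hRD (Metric.ball_subset_closedBall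
        (hballR hx))))).congr hfx.symm) (hlap x hx) hs hsr, hfx.eq_of_nhds]
  have hc0 : c ≠ 0 := by
    refine ((integral_pos_iff_support_of_nonneg hρ.nonneg hρ.integrable).mpr ?_).ne'
    exact (Metric.measure_ball_pos volume (0 : E N) one_pos).trans_le
      (measure_mono fun w hw => (hρ.pos w (by simpa using hw)).ne')
  -- A global `C²`, compactly supported representative of `u` on `ball x₀ r`; any radius strictly
  -- between `0` and `r` would do.
  set V : (E N) → ℝ := fun x => c⁻¹ * mollify f (r / 2) x with hV
  have hfc : HasCompactSupport f :=
    HasCompactSupport.intro (isCompact_closedBall x₀ R) fun z hz => Set.indicator_of_notMem hz _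
  have hVs : ContDiff ℝ 2 V := contDiff_const.mul (contDiff_mollify hfi (half_pos hr0))
  have hVc : HasCompactSupport V :=
    (hasCompactSupport_mollify hfc (half_pos hr0)).mul_left (f := fun _ => c⁻¹)
  have hVu : ∀ x ∈ Metric.ball x₀ r, V x = u x := fun x hx => by
    simp only [hV]
    rw [mollify_apply, integral_mul_kernel f x (half_pos hr0),
      hmean x hx _ (half_pos hr0) (half_lt_self hr0), inv_mul_cancel_left₀ hc0]
  have hVlap : ∀ x ∈ Metric.ball x₀ r, Laplacian.laplacian V x = 0 := fun x hx => by
    have hlim := hρ.tendsto_integral_difference hVs hVc ⟨0, hN⟩ x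
    have hd : 0 < r - dist x x₀ := sub_pos.mpr (Metric.mem_ball.mp hx)
    have hz : ∀ᶠ t : ℝ in 𝓝[>] 0,
        (∫ w, profile (‖w‖ ^ 2) * (V (x + t • w) - V x)) / t ^ 2 = 0 := by
      filter_upwards [Ioo_mem_nhdsGT hd] with t ht
      have htr : t < r := ht.2.trans_le (by linarith [dist_nonneg (x := x) (y := x₀)])
      -- For small `t` only points of `ball x₀ r` contribute. There `V = u = f`, so the weighted
      -- mean value property annihilates the average.
      have heq : ∀ w : E N, profile (‖w‖ ^ 2) * (V (x + t • w) - V x) =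
          profile (‖w‖ ^ 2) * f (x + t • w) - profile (‖w‖ ^ 2) * u x := fun w => by
        rcases le_or_gt 1 ‖w‖ with hw | hw
        · simp [hρ.eq_zero w hw]
        · have hmem : x + t • w ∈ Metric.ball x₀ r := by
            rw [Metric.mem_ball]
            have h1 := dist_triangle (x + t • w) x x₀
            rw [dist_self_add_left, norm_smul, Real.norm_of_nonneg ht.1.le] at h1
            nlinarith [ht.1, ht.2]
          rw [hVu _ hmem, hVu x hx, (hfu _ (hballR hmem)).eq_of_nhds, mul_sub]
      have hi : Integrable fun w => profile (‖w‖ ^ 2) * f (x + t • w) :=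
        hρ.integrable.mul_bdd (hfm.comp (by fun_prop)).aestronglyMeasurable
          (ae_of_all _ fun w => hfM _)
      simp only [heq]
      rw [integral_sub hi (hρ.integrable.mul_const _), hmean x hx t ht.1 htr, integral_mul_const,
        sub_self, zero_div]
    have h0 := tendsto_nhds_unique (tendsto_const_nhds.congr' (hz.mono fun t ht => ht.symm)) hlim
    exact (mul_eq_zero.mp h0.symm).resolve_left
      (half_pos (hρ.integral_coord_sq_pos ⟨0, hN⟩)).ne'
  have hnhds : Metric.ball x₀ r ∈ 𝓝 x₀ := Metric.ball_mem_nhds x₀ hr0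
  refine (InnerProductSpace.harmonicAt_congr_nhds (f₁ := V) ?_).mp ⟨hVs.contDiffAt, ?_⟩
  · filter_upwards [hnhds] with x hx using hVu x hx
  · filter_upwards [hnhds] with x hx using hVlap x hx

end BallWalk

theorem theorem2p9 {N : ℕ} (hN : 1 ≤ N)
    (D : Set (EuclideanSpace ℝ (Fin N)))
    (hDopen : IsOpen D) (hDbdd : Bornology.IsBounded D) (hDconn : IsConnected D)
    (F : EuclideanSpace ℝ (Fin N) → ℝ) (hF : ContinuousOn F (frontier D))
    (ε : ℕ → ℝ) (hε : ∀ k, ε k ∈ Set.Ioo (0 : ℝ) 1) (hε0 : Tendsto ε atTop (𝓝 0))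
    (u : EuclideanSpace ℝ (Fin N) → ℝ) (hu : ContinuousOn u D)
    (hconv : TendstoLocallyUniformlyOn (fun k => BallWalk.value D F (ε k)) u atTop D) :
    InnerProductSpace.HarmonicOnNhd u D := by
  obtain ⟨G, hG⟩ := BallWalk.exists_boundedContinuous_eqOn_frontier hDbdd hF
  refine BallWalk.harmonicOnNhd_of_integral_mul_laplacian hN hDopen hu fun φ hφ hc hsupp => ?_
  refine BallWalk.isRadialWeight_indicator.integral_mul_laplacian_eq_zero ⟨0, hN⟩
    (v := fun k => D.indicator (BallWalk.value D F (ε k))) (M := ‖G‖)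
    (fun k => BallWalk.measurable_indicator_value hN hDopen hDbdd hG (hε k).1) (fun k z => ?_)
    (fun z => ?_) hε hε0 hφ hc ?_
  · by_cases hz : z ∈ D
    · simpa [hz] using BallWalk.abs_value_le hN hDopen hDbdd hG (hε k).1 hz
    · simp [hz]
  · by_cases hz : z ∈ D
    · simpa [hz] using hconv.tendsto_at hz
    · simp [hz]
  -- The support of `φ` has a `δ`-neighbourhood inside `D`, which is disjoint from its frontier.
  -- Once `ε k < δ`, the minimum in the step length is `ε k` on the whole support.
  · obtain ⟨δ, hδ, hδD⟩ := hc.isCompact.exists_thickening_subset_open hDopen hsupp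
    filter_upwards [hε0.eventually (gt_mem_nhds hδ)] with k hk x hx
    have hxD := hsupp hx
    have hd : ε k ≤ Metric.infDist x (frontier D) := by
      refine hk.le.trans ((Metric.le_infDist
        (BallWalk.frontier_nonempty hN hDconn.nonempty hDbdd)).mpr fun y hy => ?_)
      by_contra hlt
      have hyD : y ∈ D := hδD (Metric.mem_thickening_iff.mpr
        ⟨x, hx, by rw [dist_comm]; exact not_le.mp hlt⟩)
      rw [hDopen.frontier_eq] at hy
      exact hy.2 hyD
    have := BallWalk.indicator_value_eq_average hN hDopen hDbdd hG (hε k).1 hxD hd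
    rw [← integral_indicator Metric.isOpen_ball.measurableSet] at this
    rw [← this]
    refine integral_congr_ae (ae_of_all _ fun w => ?_)
    by_cases hw : w ∈ Metric.ball (0 : EuclideanSpace ℝ (Fin N)) 1
    · simp only [Set.indicator_of_mem hw, one_mul]
    · simp only [Set.indicator_of_notMem hw, zero_mul]
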